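/- Let $M$ be an $n$-dimensional smooth manifold and let $x : M \to \mathbb{E}^N$ be a smooth immersion which is a proper map (the preimage of every compact set is compact). Give $M$ the induced Riemannian metric $g$. Let $h$ be its second fundamental form, $A$ its Weingarten map ($\langle A_\xi X, Y\rangle = \langle h(X,Y),\xi\rangle$), $\Delta^\perp$ the (non-positive) Laplacian of the normal connection, and $H = \frac1n \sum_{i=1}^n h(e_i,e_i)$ the mean curvature vector, where $\{e_i\}$ is a local orthonormal frame of $M$. Suppose that $x$ is biminimal with a constant $\lambda \ge 0$, in either of the following two customary senses: (a) $x$ is a critical point of $$E_{2,\lambda}(\varphi) = \frac12\int_M |\tau(\varphi)|^2\, v_g + \frac{\lambda}{2}\int_M |d\varphi|^2\, v_g, \qquad \tau(\varphi) = \operatorname{trace}_g \nabla d\varphi ,$$ for all smooth variations $\varphi_t : M \to \mathbb{E}^N$ $(-\varepsilon < t < \varepsilon)$ with $\varphi_0 = x$ that are constant in $t$ outside a compact set $K\subset M$ (the integrals then being taken over $K$) and whose variation vector field $\frac{d\varphi_t}{dt}\big|_{t=0}$ is normal to $M$, the metric $g$ being kept fixed; or (b) $\Delta^\perp H - \sum_{i=1}^n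 h(A_H e_i, e_i) = \lambda H$ on $M$. Then $M$ is minimal, that is, $H = 0$ on $M$. -/

import Mathlib

open Set MeasureTheory Manifold
open scoped ContDiff Topology

noncomputable section

namespace BiminimalSubmanifold

/-- Euclidean space of dimension `k`. -/
abbrev Euc (k : ℕ) : Type := EuclideanSpace ℝ (Fin k)

/-! ### Local geometry of a parametrization

In this section `f` is an immersion of an open subset of `ℝⁿ` into `ℝᴺ`, `g` is the metric that it
induces, and all fields are read in the coordinates of `ℝⁿ`.  Only the germ at `u` of the functions
involved matters for the values at `u`. -/

section Local

variable {n N : ℕ}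

/-- The partial derivative `∂ᵢ F` at the point `u`. -/
def pd {W : Type*} [NormedAddCommGroup W] [NormedSpace ℝ W] (i : Fin n) (F : Euc n → W)
    (u : Euc n) : W :=
  fderiv ℝ F u (EuclideanSpace.single i (1 : ℝ))

/-- The induced metric `g_{ij} = ⟨∂ᵢ f, ∂ⱼ f⟩`. -/
def metric (f : Euc n → Euc N) (u : Euc n) : Matrix (Fin n) (Fin n) ℝ :=
  Matrix.of fun i j => inner ℝ (pd i f u) (pd j f u)

/-- The inverse `g^{ij}` of the induced metric. -/
def metricInv (f : Euc n → Euc N) (u : Euc n) : Matrix (Fin n) (Fin n) ℝ :=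
  (metric f u)⁻¹

/-- The Christoffel symbols `Γᵏ_{ij}` of the Levi-Civita connection of the induced metric. -/
def christoffel (f : Euc n → Euc N) (k i j : Fin n) (u : Euc n) : ℝ :=
  (1 / 2 : ℝ) * ∑ l, metricInv f u k l *
    (pd i (fun w => metric f w j l) u + pd j (fun w => metric f w i l) u
      - pd l (fun w => metric f w i j) u)

/-- The orthogonal projection of `ℝᴺ` onto the normal space, the orthogonal complement of the
tangent space `range (df_u)`. -/
def normalProj (f : Euc n → Euc N) (u : Euc n) : Euc N →L[ℝ] Euc N :=
  ((fderiv ℝ f u).range)ᗮ.starProjection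

/-- The second fundamental form `h(∂ᵢ, ∂ⱼ) = (∂ᵢ ∂ⱼ f)^⊥`. -/
def secondForm (f : Euc n → Euc N) (i j : Fin n) (u : Euc n) : Euc N :=
  normalProj f u (pd i (pd j f) u)

/-- The mean curvature vector `(1/n) ∑ g^{ij} h(∂ᵢ, ∂ⱼ)`, that is, `(1/n) ∑ h(eᵢ, eᵢ)` for any
orthonormal basis `eᵢ` of the tangent space. -/
def meanCurvatureLoc (f : Euc n → Euc N) (u : Euc n) : Euc N :=
  (1 / (n : ℝ)) • ∑ i, ∑ j, metricInv f u i j • secondForm f i j u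

/-- The coefficient of `∂ₖ` in `A_ξ ∂ᵢ`, where `A_ξ` is the Weingarten map, determined by
`⟨A_ξ X, Y⟩ = ⟨h(X, Y), ξ⟩`. -/
def shapeCoeff (f : Euc n → Euc N) (ξ : Euc N) (k i : Fin n) (u : Euc n) : ℝ :=
  ∑ l, metricInv f u k l * inner ℝ (secondForm f i l u) ξ

/-- The sum `∑ h(A_ξ eᵢ, eᵢ)` over an orthonormal basis of the tangent space, that is,
`∑ g^{ij} h(A_ξ ∂ᵢ, ∂ⱼ)`. -/
def secondFormShapeTrace (f : Euc n → Euc N) (ξ : Euc N) (u : Euc n) : Euc N :=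
  ∑ i, ∑ j, metricInv f u i j • ∑ k, shapeCoeff f ξ k i u • secondForm f k j u

/-- The normal connection `∇^⊥_{∂ᵢ} ξ = (∂ᵢ ξ)^⊥`. -/
def normalDeriv (f : Euc n → Euc N) (i : Fin n) (ξ : Euc n → Euc N) (u : Euc n) : Euc N :=
  normalProj f u (pd i ξ u)

/-- The (non-positive) Laplacian of the normal connection,
`Δ^⊥ ξ = ∑ g^{ij} (∇^⊥_{∂ᵢ} ∇^⊥_{∂ⱼ} ξ - ∇^⊥_{∇_{∂ᵢ} ∂ⱼ} ξ)`. -/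
def normalLaplacianLoc (f : Euc n → Euc N) (ξ : Euc n → Euc N) (u : Euc n) : Euc N :=
  ∑ i, ∑ j, metricInv f u i j •
    (normalDeriv f i (normalDeriv f j ξ) u - ∑ k, christoffel f k i j u • normalDeriv f k ξ u)

/-- The tension field `τ(φ) = trace ∇dφ = ∑ g^{ij} (∂ᵢ ∂ⱼ φ - Γᵏ_{ij} ∂ₖ φ)` of a map `φ` into
`ℝᴺ`, with respect to the metric `g` induced by `f`. -/
def tensionLoc (f φ : Euc n → Euc N) (u : Euc n) : Euc N :=
  ∑ i, ∑ j, metricInv f u i j • (pd i (pd j φ) u - ∑ k, christoffel f k i j u • pd k φ u)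

/-- `|dφ|² = ∑ g^{ij} ⟨∂ᵢ φ, ∂ⱼ φ⟩`, with respect to the metric `g` induced by `f`. -/
def normSqDiffLoc (f φ : Euc n → Euc N) (u : Euc n) : ℝ :=
  ∑ i, ∑ j, metricInv f u i j * inner ℝ (pd i φ u) (pd j φ u)

end Local

/-! ### Immersed submanifolds

Here `x : M → ℝᴺ` is an immersion and `M` carries the metric induced by `x`.  The quantities below
do not depend on the chart; at each point `p` they are computed in the preferred chart at `p`. -/

section Global

variable {n N : ℕ} {M : Type*} [TopologicalSpace M] [ChartedSpace (Euc n) M]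

/-- The map `F` on `M` read in the preferred chart at `p`. -/
def inChart {W : Type*} (p : M) (F : M → W) : Euc n → W :=
  fun u => F ((chartAt (Euc n) p).symm u)

/-- The coordinates of `p` in the preferred chart at `p`. -/
def coords (p : M) : Euc n := chartAt (Euc n) p p

/-- An immersion of `M` into `ℝᴺ`: a smooth map with injective differential at every point. -/
def IsSmoothImmersion (x : M → Euc N) : Prop :=
  ContMDiff (𝓡 n) 𝓘(ℝ, Euc N) ∞ x ∧
    ∀ p : M, Function.Injective (mfderiv (𝓡 n) 𝓘(ℝ, Euc N) x p)

/-- The mean curvature vector field `H` of the immersion `x`. -/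
def meanCurvature (x : M → Euc N) (p : M) : Euc N :=
  meanCurvatureLoc (inChart (n := n) p x) (coords p)

/-- The Laplacian `Δ^⊥ ξ` of a normal vector field `ξ` along `x`. -/
def normalLaplacian (x ξ : M → Euc N) (p : M) : Euc N :=
  normalLaplacianLoc (inChart (n := n) p x) (inChart p ξ) (coords p)

/-- `∑ h(A_ξ eᵢ, eᵢ)` at the point `p`, for a normal vector field `ξ` along `x`. -/
def shapeTerm (x ξ : M → Euc N) (p : M) : Euc N :=
  secondFormShapeTrace (inChart (n := n) p x) (ξ p) (coords p)

/-- The equation `Δ^⊥ H - ∑ h(A_H eᵢ, eᵢ) = lam H` on all of `M`. -/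
def BiminimalEquation (n : ℕ) {N : ℕ} {M : Type*} [TopologicalSpace M] [ChartedSpace (Euc n) M]
    (x : M → Euc N) (lam : ℝ) : Prop :=
  ∀ p : M, normalLaplacian (n := n) x (meanCurvature (n := n) x) p
    - shapeTerm (n := n) x (meanCurvature (n := n) x) p = lam • meanCurvature (n := n) x p

/-! ### The variational notion -/

/-- The tension field of `φ : (M, g) → ℝᴺ`, where `g` is the metric induced by `x`. -/
def tension (x φ : M → Euc N) (p : M) : Euc N :=
  tensionLoc (inChart (n := n) p x) (inChart p φ) (coords p)

/-- `|dφ|²` for `φ : (M, g) → ℝᴺ`, where `g` is the metric induced by `x`. -/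
def normSqDiff (x φ : M → Euc N) (p : M) : ℝ :=
  normSqDiffLoc (inChart (n := n) p x) (inChart p φ) (coords p)

/-- The measure `√(det g) du` of the coordinate domain of the chart `e`, as a measure on `M`. -/
def chartVolume [MeasurableSpace M] (x : M → Euc N) (e : OpenPartialHomeomorph M (Euc n)) :
    Measure M :=
  Measure.map e.symm ((volume.restrict e.target).withDensity
    fun u => ENNReal.ofReal (Real.sqrt (metric (fun w => x (e.symm w)) u).det))

/-- The Riemannian volume measure of the metric induced by `x`.  The measures `√(det g) du` of the
coordinate domains agree on overlaps, and the volume is the smallest measure on `M` that dominates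
them all, that is, the one which they are the restrictions of. -/
def inducedVolume (n : ℕ) {N : ℕ} {M : Type*} [TopologicalSpace M] [ChartedSpace (Euc n) M]
    [MeasurableSpace M] (x : M → Euc N) : Measure M :=
  ⨆ e ∈ atlas (Euc n) M, chartVolume x e

/-- `E_{2,lam}(φ) = E₂(φ) + lam E(φ) = ½ ∫ |τ(φ)|² + lam ½ ∫ |dφ|²`, integrated over the part `K`
of `M`, with respect to the metric induced by `x`. -/
def biEnergy (n : ℕ) {N : ℕ} {M : Type*} [TopologicalSpace M] [ChartedSpace (Euc n) M]
    [MeasurableSpace M] (x : M → Euc N) (lam : ℝ) (K : Set M) (φ : M → Euc N) : ℝ :=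
  (1 / 2 : ℝ) * (∫ p in K, ‖tension (n := n) x φ p‖ ^ 2 ∂(inducedVolume n x))
    + lam * ((1 / 2 : ℝ) * ∫ p in K, normSqDiff (n := n) x φ p ∂(inducedVolume n x))

/-- A smooth variation `Φ t`, `-ε < t < ε`, of `x` which is constant off the compact set `K` and
whose variation vector field `dΦ t / dt` at `t = 0` is normal. -/
structure IsNormalVariation (n : ℕ) {N : ℕ} {M : Type*} [TopologicalSpace M]
    [ChartedSpace (Euc n) M] (x : M → Euc N) (K : Set M) (ε : ℝ) (Φ : ℝ → M → Euc N) : Prop where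
  pos : 0 < ε
  compact : IsCompact K
  smooth : ContMDiffOn (𝓘(ℝ, ℝ).prod (𝓡 n)) 𝓘(ℝ, Euc N) ∞ (fun z : ℝ × M => Φ z.1 z.2)
    (Ioo (-ε) ε ×ˢ univ)
  start : Φ 0 = x
  fixed : ∀ t ∈ Ioo (-ε) ε, ∀ p ∉ K, Φ t p = x p
  normal : ∀ (p : M) (v : TangentSpace (𝓡 n) p),
    inner ℝ (deriv (fun t => Φ t p) 0) (mfderiv (𝓡 n) 𝓘(ℝ, Euc N) x p v : Euc N) = 0

/-- The immersion `x` is biminimal with constant `lam`: it is a critical point of `E_{2,lam}` for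
all smooth compactly supported variations with normal variation vector field. -/
def IsBiminimal (n : ℕ) {N : ℕ} {M : Type*} [TopologicalSpace M] [ChartedSpace (Euc n) M]
    [MeasurableSpace M] (x : M → Euc N) (lam : ℝ) : Prop :=
  ∀ (K : Set M) (ε : ℝ) (Φ : ℝ → M → Euc N), IsNormalVariation n x K ε Φ →
    HasDerivAt (fun t => biEnergy n x lam K (Φ t)) 0 0

end Global

end BiminimalSubmanifold

end

open Set MeasureTheory Manifold
open scoped ContDiff Topology

noncomputable section

namespace BiminimalSubmanifold

/-! ### Frames, tangential parts and the Laplacian of the induced metric -/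

section LocalGeometry

variable {n N : ℕ} {W : Type*} [NormedAddCommGroup W] [NormedSpace ℝ W]

/-! Both hypotheses yield one scalar identity, `⟨ΔH, H⟩ = λ|H|²`, in which `Δ` acts on `H`
componentwise, as on a map into `ℝᴺ`. For (b) this holds because, for a normal field `ξ`, the
expressions `Δξ` and `Δ^⊥ ξ - ∑ h(A_ξ eᵢ, eᵢ)` have the same product with `ξ`
(`inner_normalLaplacianLoc_sub`). For (a), put `θ = ⟨ΔH - λH, H⟩` and vary `x` along the normal
field `ηθH`, with `η` a bump function in a chart. After Green's formula
(`ImmersedOn.setIntegral_green`) the first variation is `n ∫ ηθ²`, so `θ = 0`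
(`inner_tension_meanCurvature_of_isBiminimal`).

The identity gives `½ Δ|H|² = λ|H|² + |dH|²`. The tangential part of `dH` is `-A_H`, of trace
`-n|H|²`, so Cauchy-Schwarz yields `|dH|² ≥ n|H|⁴`; since `λ ≥ 0`, it follows that `Δ|H|² ≥ 2n|H|⁴`.
This superlinear growth allows a localized maximum principle with no curvature assumption, because
the cutoff is built from `|x|²`, and `Δ|x|² = 2n(1 + ⟨H, x⟩)` is controlled by `H` itself. As `x` is
proper, `{|x| ≤ R}` is compact and `(R² - |x|²)²|H|²` attains its maximum there. The first and
second order conditions at an interior maximum give `(R² - |x|²)|H| ≤ 5R` (`bound_of_isLocalMax`),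
the bound passes to every point with `|x| < R` (`bound_meanCurvature`), and a large `R` forces `H =
0` (`meanCurvature_eq_zero`).

The computations take place in charts. They fit together because the Laplacian is invariant under
reparametrization (`lap_comp`) and the volume is `√(det g) du` in every chart
(`inducedVolume_restrict_source`). -/

/-- The Laplacian of a vector-valued function in the metric induced by `f`. -/
def lap (f : Euc n → Euc N) (F : Euc n → W) (u : Euc n) : W :=
  ∑ i, ∑ j, metricInv f u i j • (pd i (pd j F) u - ∑ k, christoffel f k i j u • pd k F u)

/-- `f` restricts to a smooth immersion of the open set `U`. -/
structure ImmersedOn (f : Euc n → Euc N) (U : Set (Euc n)) : Prop where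
  isOpen : IsOpen U
  contDiffOn : ContDiffOn ℝ ∞ f U
  injective : ∀ u ∈ U, Function.Injective (fderiv ℝ f u)

/-- The `i`-th coordinate vector. -/
abbrev cvec (i : Fin n) : Euc n := EuclideanSpace.single i (1 : ℝ)

theorem sum_smul_cvec (v : Euc n) : ∑ i, v i • cvec i = v := by
  have := (EuclideanSpace.basisFun (Fin n) ℝ).sum_repr v
  simpa using this

theorem map_eq_sum_cvec (L : Euc n →L[ℝ] W) (v : Euc n) : L v = ∑ i, v i • L (cvec i) := by
  conv_lhs => rw [← sum_smul_cvec v]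
  simp only [map_sum, map_smul]

theorem pd_pd_eq {F : Euc n → W} {u : Euc n} (hF : ContDiffAt ℝ 2 F u) (i j : Fin n) :
    pd i (pd j F) u = fderiv ℝ (fderiv ℝ F) u (cvec i) (cvec j) := by
  have h : DifferentiableAt ℝ (fderiv ℝ F) u :=
    (hF.fderiv_right (m := 1) (by norm_num)).differentiableAt (by norm_num)
  have := (h.hasFDerivAt.clm_apply (hasFDerivAt_const (cvec j) u)).fderiv
  unfold pd
  rw [this]
  simp

theorem fderiv_fderiv_symm {F : Euc n → W} {u : Euc n} (hF : ContDiffAt ℝ 2 F u) (v w : Euc n) :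
    fderiv ℝ (fderiv ℝ F) u v w = fderiv ℝ (fderiv ℝ F) u w v :=
  (hF.isSymmSndFDerivAt (by simp)).eq v w

theorem pd_pd_symm {F : Euc n → W} {u : Euc n} (hF : ContDiffAt ℝ 2 F u) (i j : Fin n) :
    pd i (pd j F) u = pd j (pd i F) u := by
  rw [pd_pd_eq hF, pd_pd_eq hF, fderiv_fderiv_symm hF]

theorem pd_congr {F G : Euc n → W} {u : Euc n} (h : F =ᶠ[𝓝 u] G) (i : Fin n) :
    pd i F =ᶠ[𝓝 u] pd i G := by
  filter_upwards [h.fderiv (𝕜 := ℝ)] with w hw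
  simp [pd, hw]

theorem pd_inner {F G : Euc n → Euc N} {u : Euc n} (hF : DifferentiableAt ℝ F u)
    (hG : DifferentiableAt ℝ G u) (i : Fin n) :
    pd i (fun w => (inner ℝ (F w) (G w) : ℝ)) u
      = inner ℝ (pd i F u) (G u) + inner ℝ (F u) (pd i G u) := by
  unfold pd
  rw [fderiv_inner_apply ℝ hF hG]
  ring

theorem differentiableAt_pd {F : Euc n → W} {u : Euc n} (hF : ContDiffAt ℝ 2 F u) (i : Fin n) :
    DifferentiableAt ℝ (pd i F) u := by
  have h : DifferentiableAt ℝ (fderiv ℝ F) u :=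
    (hF.fderiv_right (m := 1) (by norm_num)).differentiableAt (by norm_num)
  exact h.clm_apply (differentiableAt_const _)

theorem contDiffOn_pd {F : Euc n → W} {U : Set (Euc n)} (hU : IsOpen U) (hF : ContDiffOn ℝ ∞ F U)
    (i : Fin n) : ContDiffOn ℝ ∞ (pd i F) U :=
  (hF.fderiv_of_isOpen hU (m := ∞) (by simp)).clm_apply contDiffOn_const

section Pointwise

variable {f : Euc n → Euc N} {u : Euc n}

theorem posDef_metric (h : Function.Injective (fderiv ℝ f u)) : (metric f u).PosDef := by
  refine Matrix.posDef_gram_of_linearIndependent (𝕜 := ℝ) (v := fun i => pd i f u) ?_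
  have h1 : LinearIndependent ℝ (fun i : Fin n => cvec i) := by
    have := (EuclideanSpace.basisFun (Fin n) ℝ).orthonormal.linearIndependent
    rwa [show ⇑(EuclideanSpace.basisFun (Fin n) ℝ) = fun i => cvec i from
      funext fun i => EuclideanSpace.basisFun_apply _ _ i] at this
  exact h1.map' (fderiv ℝ f u : Euc n →ₗ[ℝ] Euc N) (LinearMap.ker_eq_bot.2 h)

theorem det_metric_pos (h : Function.Injective (fderiv ℝ f u)) : 0 < (metric f u).det :=
  (posDef_metric h).det_pos

theorem metric_symm (f : Euc n → Euc N) (u : Euc n) (i j : Fin n) :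
    metric f u i j = metric f u j i :=
  real_inner_comm (pd j f u) (pd i f u)

theorem metricInv_symm (f : Euc n → Euc N) (u : Euc n) (i j : Fin n) :
    metricInv f u i j = metricInv f u j i := by
  have h : (metric f u).transpose = metric f u := by
    ext i j; exact metric_symm f u j i
  have h2 : (metricInv f u).transpose = metricInv f u := by
    rw [metricInv, Matrix.transpose_nonsing_inv, h]
  exact congrFun (congrFun h2 j) i |>.symm ▸ rfl

theorem metricInv_mul (h : Function.Injective (fderiv ℝ f u)) :
    metricInv f u * metric f u = 1 :=
  Matrix.nonsing_inv_mul _ (isUnit_iff_ne_zero.2 (det_metric_pos h).ne')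

theorem metric_mul_metricInv (h : Function.Injective (fderiv ℝ f u)) :
    metric f u * metricInv f u = 1 :=
  Matrix.mul_nonsing_inv _ (isUnit_iff_ne_zero.2 (det_metric_pos h).ne')

/-- The coefficient of `∂ₖ f` in the tangential part of `w`. -/
def tanCoeff (f : Euc n → Euc N) (u : Euc n) (w : Euc N) (k : Fin n) : ℝ :=
  ∑ l, metricInv f u k l * inner ℝ w (pd l f u)

/-- The coefficients `tanCoeff` solve the normal equations: pairing `∑ cₖ ∂ₖf` with `∂ₘf` applies
the Gram matrix, which cancels its inverse. -/
theorem inner_tan (h : Function.Injective (fderiv ℝ f u)) (w : Euc N) (m : Fin n) :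
    inner ℝ (∑ k, tanCoeff f u w k • pd k f u) (pd m f u) = (inner ℝ w (pd m f u) : ℝ) := by
  have h1 : ∀ l, ∑ k, metricInv f u k l * metric f u k m = if l = m then 1 else 0 := by
    intro l
    have := congrFun (congrFun (metricInv_mul h) l) m
    rw [Matrix.mul_apply, Matrix.one_apply] at this
    rw [← this]
    exact Finset.sum_congr rfl fun k _ => by rw [metricInv_symm]
  simp only [sum_inner, inner_smul_left, tanCoeff, Finset.sum_mul, map_sum, map_mul]
  rw [Finset.sum_comm]
  calc _ = ∑ l, inner ℝ w (pd l f u) * ∑ k, metricInv f u k l * metric f u k m := by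
        refine Finset.sum_congr rfl fun l _ => ?_
        rw [Finset.mul_sum]
        refine Finset.sum_congr rfl fun k _ => ?_
        simp [metric]; ring
    _ = _ := by simp [h1]

theorem inner_fderiv_eq_zero_iff (w : Euc N) :
    (∀ v, inner ℝ w (fderiv ℝ f u v) = (0 : ℝ)) ↔ ∀ i, inner ℝ w (pd i f u) = (0 : ℝ) := by
  refine ⟨fun h i => h _, fun h v => ?_⟩
  rw [map_eq_sum_cvec, inner_sum]
  refine Finset.sum_eq_zero fun i _ => ?_
  rw [inner_smul_right]
  simp [show inner ℝ w ((fderiv ℝ f u) (cvec i)) = (0 : ℝ) from h i]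

/-- An explicit formula for a projection defined abstractly; smooth dependence on `u` is read off
from it. -/
theorem normalProj_eq (h : Function.Injective (fderiv ℝ f u)) (w : Euc N) :
    normalProj f u w = w - ∑ k, tanCoeff f u w k • pd k f u := by
  unfold normalProj
  refine Submodule.eq_starProjection_of_mem_orthogonal ?_ ?_
  · rw [Submodule.mem_orthogonal']
    rintro _ ⟨v, rfl⟩
    refine (inner_fderiv_eq_zero_iff (f := f) (u := u) _).2 (fun i => ?_) v
    rw [inner_sub_left, inner_tan h, sub_self]
  · rw [sub_sub_cancel]
    refine Submodule.le_orthogonal_orthogonal _ ?_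
    exact Submodule.sum_mem _ fun k _ => Submodule.smul_mem _ _ ⟨_, rfl⟩

theorem inner_normalProj_pd (h : Function.Injective (fderiv ℝ f u)) (w : Euc N) (i : Fin n) :
    inner ℝ (normalProj f u w) (pd i f u) = (0 : ℝ) := by
  rw [normalProj_eq h, inner_sub_left, inner_tan h, sub_self]

theorem inner_normalProj_of_normal (h : Function.Injective (fderiv ℝ f u)) (w : Euc N) {ξ : Euc N}
    (hξ : ∀ i, inner ℝ ξ (pd i f u) = (0 : ℝ)) :
    inner ℝ (normalProj f u w) ξ = (inner ℝ w ξ : ℝ) := by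
  rw [normalProj_eq h, inner_sub_left, sum_inner, Finset.sum_eq_zero, sub_zero]
  intro k _
  rw [inner_smul_left, real_inner_comm, hξ, mul_zero]

theorem pd_metric (hf : ContDiffAt ℝ 2 f u) (i j l : Fin n) :
    pd i (fun w => metric f w j l) u
      = inner ℝ (pd i (pd j f) u) (pd l f u) + inner ℝ (pd j f u) (pd i (pd l f) u) :=
  pd_inner (differentiableAt_pd hf j) (differentiableAt_pd hf l) i

/-- When the three derivatives of `g` are expanded, symmetry of second derivatives leaves only
`2⟨∂ᵢ∂ⱼf, ∂ₗf⟩`: the Levi-Civita connection is the tangential part of the flat one. -/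
theorem christoffel_eq (hf : ContDiffAt ℝ 2 f u) (k i j : Fin n) :
    christoffel f k i j u = tanCoeff f u (pd i (pd j f) u) k := by
  unfold christoffel tanCoeff
  rw [Finset.mul_sum]
  refine Finset.sum_congr rfl fun l _ => ?_
  rw [pd_metric hf, pd_metric hf, pd_metric hf, pd_pd_symm hf j i, pd_pd_symm hf l i,
    pd_pd_symm hf l j, real_inner_comm (pd j f u) (pd i (pd l f) u)]
  ring

theorem normalProj_pd_pd (h : Function.Injective (fderiv ℝ f u)) (hf : ContDiffAt ℝ 2 f u)
    (i j : Fin n) :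
    normalProj f u (pd i (pd j f) u)
      = pd i (pd j f) u - ∑ k, christoffel f k i j u • pd k f u := by
  simp only [normalProj_eq h, christoffel_eq hf]

/-- By the Gauss formula, the Christoffel terms remove exactly the tangential part of `∂ᵢ∂ⱼf`, and
the trace of what remains is `nH`. -/
theorem lap_self (h : Function.Injective (fderiv ℝ f u)) (hf : ContDiffAt ℝ 2 f u) :
    lap f f u = (n : ℝ) • meanCurvatureLoc f u := by
  rcases Nat.eq_zero_or_pos n with rfl | hn
  · simp [lap]
  · have : (n : ℝ) ≠ 0 := by positivity
    unfold meanCurvatureLoc lap secondForm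
    rw [smul_smul, mul_one_div_cancel this, one_smul]
    simp only [normalProj_pd_pd h hf]

theorem meanCurvatureLoc_eq (h : Function.Injective (fderiv ℝ f u)) (hf : ContDiffAt ℝ 2 f u) :
    meanCurvatureLoc f u = (1 / (n : ℝ)) • lap f f u := by
  unfold meanCurvatureLoc lap secondForm
  simp only [normalProj_pd_pd h hf]

theorem inner_meanCurvatureLoc_pd (h : Function.Injective (fderiv ℝ f u)) (m : Fin n) :
    inner ℝ (meanCurvatureLoc f u) (pd m f u) = (0 : ℝ) := by
  simp only [meanCurvatureLoc, secondForm, inner_smul_left, sum_inner, inner_normalProj_pd h]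
  simp

/-- `v` is an orthonormal frame at `u` in the metric induced by `f`, and `c` is the vector
`∑ ∇_{vₐ} vₐ` for the extension of `v` to constant fields. -/
structure IsFrame (f : Euc n → Euc N) (u : Euc n) (v : Fin n → Euc n) (c : Euc n) : Prop where
  orthonormal : Orthonormal ℝ fun a => fderiv ℝ f u (v a)
  drift : ∀ w, inner ℝ ((∑ a, fderiv ℝ (fderiv ℝ f) u (v a) (v a)) - fderiv ℝ f u c)
    (fderiv ℝ f u w) = (0 : ℝ)

/-- If `V` is the matrix of the frame, orthonormality reads `Vᵀ g V = 1`, hence `g⁻¹ = V Vᵀ`.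
Coordinate traces thereby become sums over the frame. -/
theorem metricInv_eq_sum {v : Fin n → Euc n}
    (hv : Orthonormal ℝ fun a => fderiv ℝ f u (v a)) (i j : Fin n) :
    metricInv f u i j = ∑ a, v a i * v a j := by
  let V : Matrix (Fin n) (Fin n) ℝ := Matrix.of fun i a => v a i
  have h1 : V.transpose * metric f u * V = 1 := by
    ext a b
    have := (orthonormal_iff_ite.1 hv) a b
    rw [map_eq_sum_cvec _ (v a), map_eq_sum_cvec _ (v b)] at this
    simp only [sum_inner, inner_sum, inner_smul_left, inner_smul_right] at this
    rw [Matrix.one_apply, ← this]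
    simp only [Matrix.mul_apply, Finset.sum_mul, V, Matrix.transpose_apply, Matrix.of_apply]
    refine Finset.sum_congr rfl fun j _ => ?_
    rw [Finset.mul_sum]
    refine Finset.sum_congr rfl fun i _ => ?_
    simp [metric, pd]; ring
  have h2 : metric f u * (V * V.transpose) = 1 := by
    have h3 : V * (V.transpose * metric f u) = 1 := mul_eq_one_comm.1 h1
    rw [← Matrix.mul_assoc] at h3
    exact mul_eq_one_comm.1 h3
  have h4 : metricInv f u = V * V.transpose := Matrix.inv_eq_right_inv h2
  rw [h4, Matrix.mul_apply]
  rfl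

theorem sum_metricInv_smul {v : Fin n → Euc n}
    (hv : Orthonormal ℝ fun a => fderiv ℝ f u (v a)) (B : Euc n →L[ℝ] Euc n →L[ℝ] W) :
    ∑ i, ∑ j, metricInv f u i j • B (cvec i) (cvec j) = ∑ a, B (v a) (v a) := by
  simp only [metricInv_eq_sum hv, Finset.sum_smul]
  symm
  calc ∑ a, B (v a) (v a) = ∑ a, ∑ i, ∑ j, (v a i * v a j) • B (cvec i) (cvec j) := by
        refine Finset.sum_congr rfl fun a _ => ?_
        conv_lhs => rw [map_eq_sum_cvec (B (v a)) (v a), map_eq_sum_cvec B (v a)]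
        simp only [_root_.sum_apply, _root_.smul_apply,
          Finset.smul_sum, smul_smul]
        rw [Finset.sum_comm]
        refine Finset.sum_congr rfl fun i _ => Finset.sum_congr rfl fun j _ => ?_
        rw [mul_comm]
    _ = _ := by
        rw [Finset.sum_comm]
        refine Finset.sum_congr rfl fun i _ => ?_
        rw [Finset.sum_comm]

/-- The vector `∑ g^{ij} Γᵏ_{ij} ∂ₖ`. -/
def driftVec (f : Euc n → Euc N) (u : Euc n) : Euc n :=
  ∑ i, ∑ j, metricInv f u i j • ∑ k, christoffel f k i j u • cvec k

theorem lap_eq_of_orthonormal {F : Euc n → W} (hF : ContDiffAt ℝ 2 F u)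
    {v : Fin n → Euc n} (hv : Orthonormal ℝ fun a => fderiv ℝ f u (v a)) :
    lap f F u = (∑ a, fderiv ℝ (fderiv ℝ F) u (v a) (v a)) - fderiv ℝ F u (driftVec f u) := by
  rw [← sum_metricInv_smul hv]
  simp only [lap, driftVec, map_sum, map_smul, smul_sub, Finset.sum_sub_distrib, pd_pd_eq hF]
  rfl

theorem isFrame_driftVec (h : Function.Injective (fderiv ℝ f u)) (hf : ContDiffAt ℝ 2 f u)
    {v : Fin n → Euc n} (hv : Orthonormal ℝ fun a => fderiv ℝ f u (v a)) :
    IsFrame f u v (driftVec f u) := by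
  refine ⟨hv, ?_⟩
  rw [← lap_eq_of_orthonormal hf hv, lap_self h hf]
  refine (inner_fderiv_eq_zero_iff _).2 fun i => ?_
  rw [inner_smul_left, inner_meanCurvatureLoc_pd h, mul_zero]

/-- The drift condition says that `df(c)` is the tangential part of `∑ D²f(vₐ, vₐ)`, and `df` is
injective. The drift is thus characterized without Christoffel symbols, in a form that transforms
easily under a change of coordinates. -/
theorem IsFrame.eq_driftVec (h : Function.Injective (fderiv ℝ f u)) (hf : ContDiffAt ℝ 2 f u)
    {v : Fin n → Euc n} {c : Euc n} (hv : IsFrame f u v c) : c = driftVec f u := by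
  have h1 := hv.drift (c - driftVec f u)
  have h2 := (isFrame_driftVec h hf hv.orthonormal).drift (c - driftVec f u)
  rw [inner_sub_left] at h1 h2
  have h3 : (inner ℝ (fderiv ℝ f u (c - driftVec f u)) (fderiv ℝ f u (c - driftVec f u)) : ℝ)
      = 0 := by
    nth_rewrite 1 [map_sub]
    rw [inner_sub_left]
    linarith
  rw [inner_self_eq_zero] at h3
  have := h (h3.trans (map_zero _).symm)
  exact sub_eq_zero.1 this

theorem IsFrame.lap_eq (h : Function.Injective (fderiv ℝ f u)) (hf : ContDiffAt ℝ 2 f u)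
    {v : Fin n → Euc n} {c : Euc n} (hv : IsFrame f u v c) {F : Euc n → W}
    (hF : ContDiffAt ℝ 2 F u) :
    lap f F u = (∑ a, fderiv ℝ (fderiv ℝ F) u (v a) (v a)) - fderiv ℝ F u c := by
  rw [lap_eq_of_orthonormal hF hv.orthonormal, hv.eq_driftVec h hf]

theorem exists_orthonormal_frame (h : Function.Injective (fderiv ℝ f u)) :
    ∃ v : Fin n → Euc n, Orthonormal ℝ fun a => fderiv ℝ f u (v a) := by
  let L : Euc n →ₗ[ℝ] Euc N := (fderiv ℝ f u : Euc n →ₗ[ℝ] Euc N)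
  have hL : Module.finrank ℝ (LinearMap.range L) = n := by
    rw [LinearMap.finrank_range_of_inj h]; simp
  let b := (stdOrthonormalBasis ℝ (LinearMap.range L)).reindex (finCongr hL)
  choose v hv using fun a => (b a).2
  refine ⟨v, ?_⟩
  have : (fun a => fderiv ℝ f u (v a)) = fun a => ((b a : LinearMap.range L) : Euc N) :=
    funext hv
  rw [this]
  exact b.orthonormal.comp_linearIsometry (LinearMap.range L).subtypeₗᵢ

theorem exists_isFrame (h : Function.Injective (fderiv ℝ f u)) (hf : ContDiffAt ℝ 2 f u) :
    ∃ v c, IsFrame f u v c := by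
  obtain ⟨v, hv⟩ := exists_orthonormal_frame h
  exact ⟨v, _, isFrame_driftVec h hf hv⟩

end Pointwise

end LocalGeometry

/-! ### Second derivatives: chain rule, product rule and the second derivative test -/

section Calculus

variable {E W W₁ W₂ : Type*} [NormedAddCommGroup E] [NormedSpace ℝ E] [NormedAddCommGroup W]
  [NormedSpace ℝ W] [NormedAddCommGroup W₁] [NormedSpace ℝ W₁] [NormedAddCommGroup W₂]
  [NormedSpace ℝ W₂] {u : E}

theorem eventually_differentiableAt {F : E → W} (hF : ContDiffAt ℝ 2 F u) :
    ∀ᶠ w in 𝓝 u, DifferentiableAt ℝ F w := by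
  filter_upwards [hF.eventually (by simp)] with w hw
  exact hw.differentiableAt (by norm_num)

theorem differentiableAt_fderiv {F : E → W} (hF : ContDiffAt ℝ 2 F u) :
    DifferentiableAt ℝ (fderiv ℝ F) u :=
  (hF.fderiv_right (m := 1) (by norm_num)).differentiableAt (by norm_num)

theorem fderiv_fderiv_comp {E' : Type*} [NormedAddCommGroup E'] [NormedSpace ℝ E'] {F : E' → W}
    {ψ : E → E'} (hF : ContDiffAt ℝ 2 F (ψ u)) (hψ : ContDiffAt ℝ 2 ψ u) (v w : E) :
    fderiv ℝ (fderiv ℝ (F ∘ ψ)) u v w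
      = fderiv ℝ (fderiv ℝ F) (ψ u) (fderiv ℝ ψ u v) (fderiv ℝ ψ u w)
        + fderiv ℝ F (ψ u) (fderiv ℝ (fderiv ℝ ψ) u v w) := by
  have h1 : fderiv ℝ (F ∘ ψ) =ᶠ[𝓝 u] fun z => (fderiv ℝ F (ψ z)).comp (fderiv ℝ ψ z) := by
    filter_upwards [hψ.continuousAt.eventually (eventually_differentiableAt hF),
      eventually_differentiableAt hψ] with z hz1 hz2
    exact fderiv_comp z hz1 hz2
  have h2 : HasFDerivAt (fun z => fderiv ℝ F (ψ z))
      ((fderiv ℝ (fderiv ℝ F) (ψ u)).comp (fderiv ℝ ψ u)) u :=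
    (differentiableAt_fderiv hF).hasFDerivAt.comp u
      (hψ.differentiableAt (by norm_num)).hasFDerivAt
  rw [h1.fderiv_eq, (h2.clm_comp (differentiableAt_fderiv hψ).hasFDerivAt).fderiv]
  simp [add_comm]

theorem fderiv_fderiv_bilin (B : W₁ →L[ℝ] W₂ →L[ℝ] W) {F : E → W₁} {G : E → W₂}
    (hF : ContDiffAt ℝ 2 F u) (hG : ContDiffAt ℝ 2 G u) (v : E) :
    fderiv ℝ (fderiv ℝ fun z => B (F z) (G z)) u v v
      = B (fderiv ℝ (fderiv ℝ F) u v v) (G u) + B (F u) (fderiv ℝ (fderiv ℝ G) u v v)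
        + (2 : ℝ) • B (fderiv ℝ F u v) (fderiv ℝ G u v) := by
  have h1 : (fderiv ℝ fun z => B (F z) (G z)) =ᶠ[𝓝 u] fun z =>
      B.precompR E (F z) (fderiv ℝ G z) + B.precompL E (fderiv ℝ F z) (G z) := by
    filter_upwards [eventually_differentiableAt hF, eventually_differentiableAt hG] with z h1 h2
    exact B.fderiv_of_bilinear h1 h2
  have hF1 := (hF.differentiableAt (by norm_num)).hasFDerivAt
  have hG1 := (hG.differentiableAt (by norm_num)).hasFDerivAt
  have hF2 := (differentiableAt_fderiv hF).hasFDerivAt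
  have hG2 := (differentiableAt_fderiv hG).hasFDerivAt
  have h2 := ((B.precompR E).hasFDerivAt_of_bilinear hF1 hG2).add
    ((B.precompL E).hasFDerivAt_of_bilinear hF2 hG1)
  rw [h1.fderiv_eq, HasFDerivAt.fderiv (f := fun z =>
      B.precompR E (F z) (fderiv ℝ G z) + B.precompL E (fderiv ℝ F z) (G z)) h2]
  simp [two_smul]
  abel

/-- Restrict `F` to the line through `u` in direction `v`. A positive second derivative would make
the maximum also a local minimum, so the restriction would be locally constant, with zero second
derivative. -/
theorem fderiv_fderiv_nonpos_of_isLocalMax {F : E → ℝ} (hF : ContDiffAt ℝ 2 F u)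
    (hmax : IsLocalMax F u) (v : E) : fderiv ℝ (fderiv ℝ F) u v v ≤ 0 := by
  by_contra! hpos
  let l : ℝ → E := fun t => u + t • v
  have hl0 : l 0 = u := by simp [l]
  have hl : ∀ t, HasDerivAt l v t := fun t => by
    have := ((hasDerivAt_id t).smul_const v).const_add u
    rwa [one_smul] at this
  have hlc : Filter.Tendsto l (𝓝 0) (𝓝 u) := by
    have := (hl 0).continuousAt.tendsto; rwa [hl0] at this
  have h1 : deriv (F ∘ l) =ᶠ[𝓝 0] fun t => fderiv ℝ F (l t) v := by
    filter_upwards [hlc.eventually (eventually_differentiableAt hF)] with t ht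
    exact (ht.hasFDerivAt.comp_hasDerivAt t (hl t)).deriv
  have h2 : HasDerivAt (fun t => fderiv ℝ F (l t) v) (fderiv ℝ (fderiv ℝ F) u v v) 0 := by
    have h3 : HasFDerivAt (fderiv ℝ F) (fderiv ℝ (fderiv ℝ F) u) (l 0) := by
      rw [hl0]; exact (differentiableAt_fderiv hF).hasFDerivAt
    have := (h3.comp_hasDerivAt 0 (hl 0)).clm_apply (hasDerivAt_const (0 : ℝ) v)
    simpa using this
  have h3 : deriv (deriv (F ∘ l)) 0 = fderiv ℝ (fderiv ℝ F) u v v := by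
    rw [h1.deriv_eq, h2.deriv]
  have h4 : IsLocalMax (F ∘ l) 0 := by
    have := hlc.eventually hmax
    simpa [IsLocalMax, IsMaxFilter, hl0] using this
  have hc : ContinuousAt (F ∘ l) 0 := by
    refine ContinuousAt.comp ?_ (hl 0).continuousAt
    rw [hl0]; exact hF.continuousAt
  have h5 := isLocalMin_of_deriv_deriv_pos (h3 ▸ hpos) h4.deriv_eq_zero hc
  have h6 : F ∘ l =ᶠ[𝓝 0] fun _ => (F ∘ l) 0 := by
    filter_upwards [h4, h5] with t a b
    exact le_antisymm a b
  have h7 : deriv (deriv (F ∘ l)) 0 = 0 := by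
    rw [h6.deriv.deriv_eq]; simp
  rw [h3] at h7
  exact hpos.ne' h7

end Calculus

/-! ### Invariance under changes of coordinates -/

section Reparametrization

variable {n N : ℕ} {W : Type*} [NormedAddCommGroup W] [NormedSpace ℝ W]
  {f : Euc n → Euc N} {u : Euc n} {ψ : Euc n → Euc n}

/-- The pushed-forward frame stays orthonormal by the chain rule. The drift is not tensorial: it
absorbs the second derivatives of `ψ`. -/
theorem IsFrame.comp {v : Fin n → Euc n} {c : Euc n} (hf : ContDiffAt ℝ 2 f (ψ u))
    (hψ : ContDiffAt ℝ 2 ψ u) (hs : Function.Surjective (fderiv ℝ ψ u))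
    (hv : IsFrame (f ∘ ψ) u v c) :
    IsFrame f (ψ u) (fun a => fderiv ℝ ψ u (v a))
      (fderiv ℝ ψ u c - ∑ a, fderiv ℝ (fderiv ℝ ψ) u (v a) (v a)) := by
  have h1 : fderiv ℝ (f ∘ ψ) u = (fderiv ℝ f (ψ u)).comp (fderiv ℝ ψ u) :=
    fderiv_comp u (hf.differentiableAt (by norm_num)) (hψ.differentiableAt (by norm_num))
  refine ⟨?_, fun w => ?_⟩
  · have := hv.orthonormal
    rwa [h1] at this
  · obtain ⟨w, rfl⟩ := hs w
    have := hv.drift w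
    rw [h1] at this
    simp only [fderiv_fderiv_comp hf hψ, Finset.sum_add_distrib] at this
    rw [← this, map_sub, map_sum]
    congr 1
    simp only [ContinuousLinearMap.comp_apply]
    abel

theorem fderiv_comp_injective (hf : ContDiffAt ℝ 2 f (ψ u))
    (hψ : ContDiffAt ℝ 2 ψ u) (h : Function.Injective (fderiv ℝ f (ψ u)))
    (hb : Function.Bijective (fderiv ℝ ψ u)) : Function.Injective (fderiv ℝ (f ∘ ψ) u) := by
  rw [fderiv_comp u (hf.differentiableAt (by norm_num)) (hψ.differentiableAt (by norm_num))]
  exact h.comp hb.1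

/-- In a frame, the terms `dF(D²ψ(vₐ, vₐ))` of the chain rule for `F ∘ ψ` match the correction of
the drift in `IsFrame.comp`. -/
theorem lap_comp (hf : ContDiffAt ℝ 2 f (ψ u)) (hψ : ContDiffAt ℝ 2 ψ u)
    (h : Function.Injective (fderiv ℝ f (ψ u))) (hb : Function.Bijective (fderiv ℝ ψ u))
    {F : Euc n → W} (hF : ContDiffAt ℝ 2 F (ψ u)) :
    lap (f ∘ ψ) (F ∘ ψ) u = lap f F (ψ u) := by
  have h' := fderiv_comp_injective hf hψ h hb
  obtain ⟨v, c, hv⟩ := exists_isFrame h' (hf.comp u hψ)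
  rw [hv.lap_eq h' (hf.comp u hψ) (hF.comp u hψ), (hv.comp hf hψ hb.2).lap_eq h hf hF]
  simp only [fderiv_fderiv_comp hF hψ, Finset.sum_add_distrib, map_sub, map_sum]
  rw [fderiv_comp u (hF.differentiableAt (by norm_num)) (hψ.differentiableAt (by norm_num))]
  simp only [ContinuousLinearMap.comp_apply]
  abel

theorem sum_metricInv_mul_inner {V : Type*} [NormedAddCommGroup V] [InnerProductSpace ℝ V]
    {v : Fin n → Euc n}
    (hv : Orthonormal ℝ fun a => fderiv ℝ f u (v a)) (A B : Euc n →L[ℝ] V) :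
    ∑ i, ∑ j, metricInv f u i j * inner ℝ (A (cvec i)) (B (cvec j))
      = ∑ a, (inner ℝ (A (v a)) (B (v a)) : ℝ) := by
  have := sum_metricInv_smul hv ((innerSL ℝ (E := V)).bilinearComp A B)
  simpa using this

theorem normSqDiffLoc_comp {φ : Euc n → Euc N} (hf : ContDiffAt ℝ 2 f (ψ u))
    (hψ : ContDiffAt ℝ 2 ψ u)
    (h : Function.Injective (fderiv ℝ f (ψ u))) (hb : Function.Bijective (fderiv ℝ ψ u))
    (hφ : ContDiffAt ℝ 2 φ (ψ u)) :
    normSqDiffLoc (f ∘ ψ) (φ ∘ ψ) u = normSqDiffLoc f φ (ψ u) := by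
  have h' := fderiv_comp_injective hf hψ h hb
  obtain ⟨v, c, hv⟩ := exists_isFrame h' (hf.comp u hψ)
  have h1 := sum_metricInv_mul_inner hv.orthonormal (fderiv ℝ (φ ∘ ψ) u) (fderiv ℝ (φ ∘ ψ) u)
  have h2 := sum_metricInv_mul_inner (hv.comp hf hψ hb.2).orthonormal
    (fderiv ℝ φ (ψ u)) (fderiv ℝ φ (ψ u))
  refine h1.trans (Eq.trans ?_ h2.symm)
  rw [fderiv_comp u (hφ.differentiableAt (by norm_num)) (hψ.differentiableAt (by norm_num))]
  rfl

/-- The Gram matrix transforms as `Jᵀ g J`, where `J` is the Jacobian matrix of `ψ`. -/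
theorem det_metric_comp (hf : DifferentiableAt ℝ f (ψ u)) (hψ : DifferentiableAt ℝ ψ u) :
    (metric (f ∘ ψ) u).det = (fderiv ℝ ψ u).det ^ 2 * (metric f (ψ u)).det := by
  let b := (EuclideanSpace.basisFun (Fin n) ℝ).toBasis
  let J : Matrix (Fin n) (Fin n) ℝ := LinearMap.toMatrix b b (fderiv ℝ ψ u)
  have hJ : J.det = (fderiv ℝ ψ u).det := LinearMap.det_toMatrix b _
  have hJ' : ∀ i a, J i a = fderiv ℝ ψ u (cvec a) i := by
    intro i a
    simp [J, LinearMap.toMatrix_apply, b]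
  have h1 : metric (f ∘ ψ) u = J.transpose * metric f (ψ u) * J := by
    ext a b
    simp only [metric, Matrix.of_apply, pd]
    rw [fderiv_comp u hf hψ]
    simp only [ContinuousLinearMap.comp_apply]
    rw [map_eq_sum_cvec _ (fderiv ℝ ψ u (cvec a)), map_eq_sum_cvec _ (fderiv ℝ ψ u (cvec b))]
    simp only [sum_inner, inner_sum, inner_smul_left, inner_smul_right, Matrix.mul_apply,
      Finset.sum_mul, Matrix.transpose_apply, hJ', Matrix.of_apply]
    refine Finset.sum_congr rfl fun j _ => ?_
    rw [Finset.mul_sum]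
    refine Finset.sum_congr rfl fun i _ => ?_
    simp; ring
  rw [h1, Matrix.det_mul, Matrix.det_mul, Matrix.det_transpose, hJ]
  ring

end Reparametrization

/-! ### Product rule, sign at a maximum, linearity and locality of the Laplacian -/

section LaplacianRules

variable {n N : ℕ} {W W₁ W₂ : Type*} [NormedAddCommGroup W]
  [NormedSpace ℝ W] [NormedAddCommGroup W₁] [NormedSpace ℝ W₁] [NormedAddCommGroup W₂]
  [NormedSpace ℝ W₂] {f : Euc n → Euc N} {u : Euc n}

/-- One product rule serves both for inner products of vector fields and for products of scalar
functions. -/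
theorem IsFrame.lap_bilin {v : Fin n → Euc n} {c : Euc n}
    (h : Function.Injective (fderiv ℝ f u)) (hf : ContDiffAt ℝ 2 f u) (hv : IsFrame f u v c)
    (B : W₁ →L[ℝ] W₂ →L[ℝ] W) {F : Euc n → W₁} {G : Euc n → W₂}
    (hF : ContDiffAt ℝ 2 F u) (hG : ContDiffAt ℝ 2 G u) :
    lap f (fun z => B (F z) (G z)) u = B (lap f F u) (G u) + B (F u) (lap f G u)
      + (2 : ℝ) • ∑ a, B (fderiv ℝ F u (v a)) (fderiv ℝ G u (v a)) := by
  have hBFG : ContDiffAt ℝ 2 (fun z => B (F z) (G z)) u :=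
    (B.contDiff.contDiffAt.comp u hF).clm_apply hG
  rw [hv.lap_eq h hf hBFG, hv.lap_eq h hf hF, hv.lap_eq h hf hG]
  rw [B.fderiv_of_bilinear (hF.differentiableAt (by norm_num)) (hG.differentiableAt (by norm_num))]
  simp only [fderiv_fderiv_bilin B hF hG, Finset.sum_add_distrib, map_sub, map_sum,
    _root_.sum_apply, _root_.sub_apply, _root_.add_apply, ContinuousLinearMap.precompR_apply,
    ContinuousLinearMap.precompL_apply, Finset.smul_sum, ContinuousLinearMap.compL_apply,
    ContinuousLinearMap.comp_apply]
  abel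

theorem lap_nonpos_of_isLocalMax (h : Function.Injective (fderiv ℝ f u)) (hf : ContDiffAt ℝ 2 f u)
    {F : Euc n → ℝ} (hF : ContDiffAt ℝ 2 F u) (hmax : IsLocalMax F u) : lap f F u ≤ 0 := by
  obtain ⟨v, c, hv⟩ := exists_isFrame h hf
  rw [hv.lap_eq h hf hF, hmax.fderiv_eq_zero]
  simpa using Finset.sum_nonpos fun a _ => fderiv_fderiv_nonpos_of_isLocalMax hF hmax (v a)

theorem lap_add {F G : Euc n → W} (h : Function.Injective (fderiv ℝ f u))
    (hf : ContDiffAt ℝ 2 f u) (hF : ContDiffAt ℝ 2 F u) (hG : ContDiffAt ℝ 2 G u) :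
    lap f (fun z => F z + G z) u = lap f F u + lap f G u := by
  have hadd : (fderiv ℝ fun z => F z + G z) =ᶠ[𝓝 u] fun z => fderiv ℝ F z + fderiv ℝ G z := by
    filter_upwards [eventually_differentiableAt hF, eventually_differentiableAt hG] with z h1 h2
    exact fderiv_add h1 h2
  obtain ⟨v, c, hv⟩ := exists_isFrame h hf
  rw [hv.lap_eq h hf hF, hv.lap_eq h hf hG, hv.lap_eq h hf (hF.add hG)]
  have h2 : fderiv ℝ (fderiv ℝ fun z => F z + G z) u
      = fderiv ℝ (fderiv ℝ F) u + fderiv ℝ (fderiv ℝ G) u := by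
    rw [hadd.fderiv_eq]
    exact fderiv_add (differentiableAt_fderiv hF) (differentiableAt_fderiv hG)
  have h3 : (fderiv ℝ fun z => F z + G z) u = fderiv ℝ F u + fderiv ℝ G u := hadd.self_of_nhds
  erw [h2, h3]
  simp only [_root_.add_apply, Finset.sum_add_distrib]
  abel

theorem lap_const_smul {F : Euc n → W} (h : Function.Injective (fderiv ℝ f u))
    (hf : ContDiffAt ℝ 2 f u) (hF : ContDiffAt ℝ 2 F u) (t : ℝ) :
    lap f (fun z => t • F z) u = t • lap f F u := by
  obtain ⟨v, c, hv⟩ := exists_isFrame h hf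
  have h1 : (fderiv ℝ fun z => t • F z) = fun z => t • fderiv ℝ F z := by
    exact fderiv_const_smul_field (𝕜 := ℝ) (f := F) t
  have h2 : fderiv ℝ (fun z => t • fderiv ℝ F z) u = t • fderiv ℝ (fderiv ℝ F) u :=
    congrFun (fderiv_const_smul_field (𝕜 := ℝ) (f := fderiv ℝ F) t) u
  rw [hv.lap_eq h hf hF, hv.lap_eq h hf (hF.const_smul t), h1, h2]
  simp [Finset.smul_sum, smul_sub]

theorem lap_congr {f' : Euc n → Euc N} {F G : Euc n → W} (hf : f =ᶠ[𝓝 u] f')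
    (hF : F =ᶠ[𝓝 u] G) : lap f F u = lap f' G u := by
  have hm : ∀ i j, (fun w => metric f w i j) =ᶠ[𝓝 u] fun w => metric f' w i j := by
    intro i j
    filter_upwards [pd_congr hf i, pd_congr hf j] with w h1 h2
    simp [metric, h1, h2]
  have hI : metricInv f u = metricInv f' u := by
    unfold metricInv
    congr 1
    ext i j
    exact (hm i j).self_of_nhds
  have hc : ∀ k i j, christoffel f k i j u = christoffel f' k i j u := by
    intro k i j
    simp only [christoffel, hI, (pd_congr (hm _ _) _).self_of_nhds]
  simp only [lap, hI, hc, (pd_congr hF _).self_of_nhds,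
    (pd_congr (pd_congr hF _) _).self_of_nhds]

end LaplacianRules

/-! ### Smoothness of the geometric quantities in a chart -/

section Smoothness

variable {n N : ℕ} {W : Type*} [NormedAddCommGroup W] [NormedSpace ℝ W]
  {f : Euc n → Euc N} {U : Set (Euc n)} {u : Euc n}

theorem contDiffOn_det {E : Type*} [NormedAddCommGroup E] [NormedSpace ℝ E] {S : Set E}
    {A : E → Matrix (Fin n) (Fin n) ℝ} (hA : ∀ i j, ContDiffOn ℝ ∞ (fun w => A w i j) S) :
    ContDiffOn ℝ ∞ (fun w => (A w).det) S := by
  simp only [Matrix.det_apply']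
  exact ContDiffOn.sum fun σ _ => contDiffOn_const.mul (contDiffOn_prod fun i _ => hA _ _)

theorem contDiffAt_two {F : Euc n → W} (hF : ContDiffOn ℝ ∞ F U) (hU : IsOpen U)
    (hu : u ∈ U) : ContDiffAt ℝ 2 F u :=
  (hF.contDiffAt (hU.mem_nhds hu)).of_le (WithTop.coe_le_coe.2 (le_top : (2 : ℕ∞) ≤ ⊤))

namespace ImmersedOn

theorem contDiffAt (hf : ImmersedOn f U) (hu : u ∈ U) : ContDiffAt ℝ 2 f u :=
  contDiffAt_two hf.contDiffOn hf.isOpen hu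

theorem contDiffOn_metric (hf : ImmersedOn f U) (i j : Fin n) :
    ContDiffOn ℝ ∞ (fun w => metric f w i j) U :=
  (contDiffOn_pd hf.isOpen hf.contDiffOn i).inner ℝ (contDiffOn_pd hf.isOpen hf.contDiffOn j)

theorem contDiffOn_det_metric (hf : ImmersedOn f U) :
    ContDiffOn ℝ ∞ (fun w => (metric f w).det) U :=
  contDiffOn_det hf.contDiffOn_metric

theorem contDiffOn_sqrt_det_metric (hf : ImmersedOn f U) :
    ContDiffOn ℝ ∞ (fun w => √(metric f w).det) U :=
  hf.contDiffOn_det_metric.sqrt fun w hw => (det_metric_pos (hf.injective w hw)).ne'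

theorem contDiffOn_metricInv (hf : ImmersedOn f U) (i j : Fin n) :
    ContDiffOn ℝ ∞ (fun w => metricInv f w i j) U := by
  -- Cramer's rule: each entry of the inverse is a quotient of determinants with smooth entries.
  have h1 : ∀ w, metricInv f w i j
      = ((metric f w).det)⁻¹ * ((metric f w).updateRow j (Pi.single i 1)).det := by
    intro w
    rw [metricInv, Matrix.inv_def, Matrix.smul_apply, Matrix.adjugate_apply, smul_eq_mul,
      Ring.inverse_eq_inv']
  simp only [h1]
  refine (hf.contDiffOn_det_metric.inv fun w hw => (det_metric_pos (hf.injective w hw)).ne').mul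
    (contDiffOn_det fun a b => ?_)
  by_cases ha : a = j
  · subst ha
    simpa using contDiffOn_const
  · simpa [Matrix.updateRow_ne ha] using hf.contDiffOn_metric a b

theorem contDiffOn_christoffel (hf : ImmersedOn f U) (k i j : Fin n) :
    ContDiffOn ℝ ∞ (christoffel f k i j) U := by
  have h := fun i j => contDiffOn_pd hf.isOpen (hf.contDiffOn_metric i j)
  unfold christoffel
  exact contDiffOn_const.mul (ContDiffOn.sum fun l _ => (hf.contDiffOn_metricInv k l).mul
    (((h _ _ _).add (h _ _ _)).sub (h _ _ _)))

theorem contDiffOn_lap (hf : ImmersedOn f U) {F : Euc n → W} (hF : ContDiffOn ℝ ∞ F U) :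
    ContDiffOn ℝ ∞ (lap f F) U := by
  have h := contDiffOn_pd hf.isOpen hF
  unfold lap
  exact ContDiffOn.sum fun i _ => ContDiffOn.sum fun j _ => (hf.contDiffOn_metricInv i j).smul
    ((contDiffOn_pd hf.isOpen (h j) i).sub (ContDiffOn.sum fun k _ =>
      (hf.contDiffOn_christoffel k i j).smul (h k)))

theorem contDiffOn_meanCurvatureLoc (hf : ImmersedOn f U) :
    ContDiffOn ℝ ∞ (meanCurvatureLoc f) U :=
  ((hf.contDiffOn_lap hf.contDiffOn).const_smul (1 / (n : ℝ))).congr fun w hw =>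
    meanCurvatureLoc_eq (hf.injective w hw) (hf.contDiffAt hw)

theorem contDiffOn_normSqDiffLoc (hf : ImmersedOn f U) {φ : Euc n → Euc N}
    (hφ : ContDiffOn ℝ ∞ φ U) : ContDiffOn ℝ ∞ (normSqDiffLoc f φ) U := by
  have h := contDiffOn_pd hf.isOpen hφ
  unfold normSqDiffLoc
  exact ContDiffOn.sum fun i _ => ContDiffOn.sum fun j _ => (hf.contDiffOn_metricInv i j).mul
    ((h i).inner ℝ (h j))

theorem contDiffOn_normalProj (hf : ImmersedOn f U) {ξ : Euc n → Euc N}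
    (hξ : ContDiffOn ℝ ∞ ξ U) : ContDiffOn ℝ ∞ (fun w => normalProj f w (ξ w)) U := by
  have h := contDiffOn_pd hf.isOpen hf.contDiffOn
  refine ContDiffOn.congr ?_ fun w hw => normalProj_eq (hf.injective w hw) (ξ w)
  unfold tanCoeff
  exact hξ.sub (ContDiffOn.sum fun k _ => (ContDiffOn.sum fun l _ =>
    (hf.contDiffOn_metricInv k l).mul (hξ.inner ℝ (h l))).smul (h k))

end ImmersedOn

end Smoothness

/-! ### Normal fields: the Weingarten relation and the normal Laplacian -/

section NormalFields

variable {n N : ℕ} {f : Euc n → Euc N} {U : Set (Euc n)} {u : Euc n} {ξ : Euc n → Euc N}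

theorem inner_pd_pd_of_normal (hf : ContDiffAt ℝ 2 f u) (hξ : DifferentiableAt ℝ ξ u) {j : Fin n}
    (hn : ∀ᶠ w in 𝓝 u, inner ℝ (ξ w) (pd j f w) = (0 : ℝ)) (i : Fin n) :
    inner ℝ (pd i ξ u) (pd j f u) = - (inner ℝ (ξ u) (pd i (pd j f) u) : ℝ) := by
  have h1 := pd_inner hξ (differentiableAt_pd hf j) i
  have h2 : pd i (fun w => (inner ℝ (ξ w) (pd j f w) : ℝ)) u = 0 := by
    have h3 : (fun w => (inner ℝ (ξ w) (pd j f w) : ℝ)) =ᶠ[𝓝 u] fun _ => 0 := hn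
    rw [(pd_congr h3 i).self_of_nhds]
    simp [pd]
  linarith

theorem inner_fderiv_fderiv_of_normal (hf : ContDiffAt ℝ 2 f u) (hξ : DifferentiableAt ℝ ξ u)
    (hn : ∀ᶠ w in 𝓝 u, ∀ j, inner ℝ (ξ w) (pd j f w) = (0 : ℝ)) (v : Euc n) :
    inner ℝ (fderiv ℝ ξ u v) (fderiv ℝ f u v)
      = - (inner ℝ (ξ u) (fderiv ℝ (fderiv ℝ f) u v v) : ℝ) := by
  have hd : HasFDerivAt (fun w => fderiv ℝ f w v)
      ((fderiv ℝ (fderiv ℝ f) u).flip v) u := by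
    simpa using (differentiableAt_fderiv hf).hasFDerivAt.clm_apply (hasFDerivAt_const v u)
  have h1 := fderiv_inner_apply ℝ hξ hd.differentiableAt v
  have h3 : (fun w => (inner ℝ (ξ w) (fderiv ℝ f w v) : ℝ)) =ᶠ[𝓝 u] fun _ => 0 := by
    filter_upwards [hn] with w hw
    exact (inner_fderiv_eq_zero_iff _).2 hw v
  rw [h3.fderiv_eq, hd.fderiv] at h1
  simp at h1
  linarith

/-- Projecting the inner derivative in `∇^⊥∇^⊥ξ` discards the tangential part of `∂ⱼξ`. Paired with
`ξ`, this loss amounts to the shape term, which is therefore subtracted to recover the flat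
Laplacian. -/
theorem inner_normalLaplacianLoc_sub (hf : ImmersedOn f U) (hξ : ContDiffOn ℝ ∞ ξ U)
    (hn : ∀ w ∈ U, ∀ j, inner ℝ (ξ w) (pd j f w) = (0 : ℝ)) (hu : u ∈ U) :
    inner ℝ (normalLaplacianLoc f ξ u - secondFormShapeTrace f (ξ u) u) (ξ u)
      = (inner ℝ (lap f ξ u) (ξ u) : ℝ) := by
  have hinj := hf.injective u hu
  have hf2 := hf.contDiffAt hu
  have hU := hf.isOpen.mem_nhds hu
  have hξ2 := contDiffAt_two hξ hf.isOpen hu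
  have hξ1 : DifferentiableAt ℝ ξ u := hξ2.differentiableAt (by norm_num)
  have key : ∀ i l, (inner ℝ (secondForm f i l u) (ξ u) : ℝ)
      = - inner ℝ (pd i ξ u) (pd l f u) := by
    intro i l
    rw [secondForm, inner_normalProj_of_normal hinj _ (hn u hu), inner_pd_pd_of_normal hf2 hξ1
      (Filter.mem_of_superset hU fun w hw => hn w hw l), neg_neg, real_inner_comm]
  have hP : ∀ i j, (inner ℝ (normalDeriv f i (normalDeriv f j ξ) u) (ξ u) : ℝ)
      = inner ℝ (pd i (pd j ξ) u) (ξ u)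
        + ∑ k, tanCoeff f u (pd j ξ u) k * inner ℝ (pd k f u) (pd i ξ u) := by
    intro i j
    have hG : DifferentiableAt ℝ (normalDeriv f j ξ) u :=
      (contDiffAt_two (hf.contDiffOn_normalProj (contDiffOn_pd hf.isOpen hξ j)) hf.isOpen
        hu).differentiableAt (by norm_num)
    -- This holds near `u`, not only at `u`, so it can be differentiated. The product rule then
    -- gives the second normal derivative without differentiating the projection.
    have h1 : (fun w => (inner ℝ (normalDeriv f j ξ w) (ξ w) : ℝ)) =ᶠ[𝓝 u]
        fun w => inner ℝ (pd j ξ w) (ξ w) := by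
      filter_upwards [hU] with w hw
      exact inner_normalProj_of_normal (hf.injective w hw) _ (hn w hw)
    have h2 := (pd_congr h1 i).self_of_nhds
    rw [pd_inner hG hξ1, pd_inner (differentiableAt_pd hξ2 j) hξ1] at h2
    have h3 : (inner ℝ (normalDeriv f j ξ u) (pd i ξ u) : ℝ) = inner ℝ (pd j ξ u) (pd i ξ u)
        - ∑ k, tanCoeff f u (pd j ξ u) k * inner ℝ (pd k f u) (pd i ξ u) := by
      rw [normalDeriv, normalProj_eq hinj, inner_sub_left, sum_inner]
      simp [inner_smul_left]
    rw [normalDeriv, inner_normalProj_of_normal hinj _ (hn u hu)]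
    linarith
  have hS : ∀ i j, (inner ℝ (∑ k, shapeCoeff f (ξ u) k i u • secondForm f k j u) (ξ u) : ℝ)
      = ∑ k, tanCoeff f u (pd j ξ u) k * inner ℝ (pd k f u) (pd i ξ u) := by
    intro i j
    have hsym : ∀ k, secondForm f k j u = secondForm f j k u := fun k => by
      rw [secondForm, secondForm, pd_pd_symm hf2]
    simp only [sum_inner, inner_smul_left, shapeCoeff, tanCoeff, hsym, key, Finset.sum_mul]
    rw [Finset.sum_comm]
    simp only [map_sum, Finset.sum_mul]
    refine Finset.sum_congr rfl fun k _ => Finset.sum_congr rfl fun l _ => ?_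
    rw [metricInv_symm f u k l, real_inner_comm (pd i ξ u) (pd l f u)]
    simp
    ring
  have hN : ∀ k, (inner ℝ (normalDeriv f k ξ u) (ξ u) : ℝ) = inner ℝ (pd k ξ u) (ξ u) := fun k =>
    inner_normalProj_of_normal hinj _ (hn u hu)
  rw [inner_sub_left]
  unfold normalLaplacianLoc secondFormShapeTrace lap
  simp only [sum_inner _ _ (ξ u), inner_smul_left, inner_sub_left, hP, hN]
  simp only [← sum_inner, ← inner_smul_left, hS]
  simp only [sum_inner _ _ (ξ u), inner_smul_left, ← Finset.sum_sub_distrib]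
  simp only [← mul_sub]
  refine Finset.sum_congr rfl fun i _ => Finset.sum_congr rfl fun j _ => ?_
  congr 1
  ring

end NormalFields

/-! ### The differential inequality for `|H|²` and the estimate at a maximum -/

section MaximumPrinciple

variable {n N : ℕ} {f : Euc n → Euc N} {U : Set (Euc n)} {u : Euc n}

theorem IsFrame.lap_inner {v : Fin n → Euc n} {c : Euc n} (h : Function.Injective (fderiv ℝ f u))
    (hf : ContDiffAt ℝ 2 f u) (hv : IsFrame f u v c) {F : Euc n → Euc N}
    (hF : ContDiffAt ℝ 2 F u) :
    lap f (fun z => (inner ℝ (F z) (F z) : ℝ)) u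
      = 2 * inner ℝ (lap f F u) (F u) + 2 * ∑ a, ‖fderiv ℝ F u (v a)‖ ^ 2 := by
  have h1 : lap f (fun z => (inner ℝ (F z) (F z) : ℝ)) u
      = inner ℝ (lap f F u) (F u) + inner ℝ (F u) (lap f F u)
        + (2 : ℝ) • ∑ a, (inner ℝ (fderiv ℝ F u (v a)) (fderiv ℝ F u (v a)) : ℝ) :=
    hv.lap_bilin h hf (innerSL ℝ (E := Euc N)) hF hF
  rw [h1, real_inner_comm (lap f F u) (F u), smul_eq_mul]
  simp only [real_inner_self_eq_norm_sq]
  ring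

theorem lap_const_sub {F : Euc n → ℝ} (h : Function.Injective (fderiv ℝ f u))
    (hf : ContDiffAt ℝ 2 f u) (hF : ContDiffAt ℝ 2 F u) (a : ℝ) :
    lap f (fun z => a - F z) u = - lap f F u := by
  obtain ⟨v, c, hv⟩ := exists_isFrame h hf
  have h1 : (fderiv ℝ fun z => a - F z) = fun z => - fderiv ℝ F z := by
    funext z; exact fderiv_const_sub a
  have h2 : fderiv ℝ (fun z => - fderiv ℝ F z) u = - fderiv ℝ (fderiv ℝ F) u := fderiv_fun_neg
  rw [hv.lap_eq h hf hF, hv.lap_eq h hf (contDiffAt_const.sub hF), h1, h2]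
  simp
  ring

/-- Cauchy-Schwarz for the tangential part of the derivative of the mean curvature vector. -/
theorem IsFrame.norm_meanCurvatureLoc_pow_four_le {v : Fin n → Euc n} {c : Euc n}
    (hf : ImmersedOn f U) (hu : u ∈ U) (hv : IsFrame f u v c) :
    n * ‖meanCurvatureLoc f u‖ ^ 4 ≤ ∑ a, ‖fderiv ℝ (meanCurvatureLoc f) u (v a)‖ ^ 2 := by
  rcases Nat.eq_zero_or_pos n with rfl | hn
  · simp
  have hinj := hf.injective u hu
  have hf2 := hf.contDiffAt hu
  have hH : DifferentiableAt ℝ (meanCurvatureLoc f) u :=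
    (contDiffAt_two hf.contDiffOn_meanCurvatureLoc hf.isOpen hu).differentiableAt (by norm_num)
  have hnor : ∀ᶠ w in 𝓝 u, ∀ j, inner ℝ (meanCurvatureLoc f w) (pd j f w) = (0 : ℝ) :=
    Filter.mem_of_superset (hf.isOpen.mem_nhds hu) fun w hw j =>
      inner_meanCurvatureLoc_pd (hf.injective w hw) j
  set H := meanCurvatureLoc f with hHdef
  -- The trace of `-A_H`: differentiating `⟨H, df(v)⟩ = 0` turns the sum into `-⟨H, ∑ D²f(vₐ, vₐ)⟩`,
  -- and the vector there is `nH` plus the tangent vector `df(c)`.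
  have h1 : ∑ a, (inner ℝ (fderiv ℝ H u (v a)) (fderiv ℝ f u (v a)) : ℝ) = - (n * ‖H u‖ ^ 2) := by
    simp only [inner_fderiv_fderiv_of_normal hf2 hH hnor]
    rw [Finset.sum_neg_distrib, ← inner_sum]
    have h2 := hv.lap_eq hinj hf2 hf2
    rw [lap_self hinj hf2] at h2
    have h3 : (inner ℝ (H u) (fderiv ℝ f u c) : ℝ) = 0 :=
      (inner_fderiv_eq_zero_iff _).2 hnor.self_of_nhds c
    rw [eq_sub_iff_add_eq] at h2
    rw [← h2, inner_add_right, h3, inner_smul_right, ← hHdef, real_inner_self_eq_norm_sq, add_zero]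
  have h2 : ∀ a, (inner ℝ (fderiv ℝ H u (v a)) (fderiv ℝ f u (v a)) : ℝ) ^ 2
      ≤ ‖fderiv ℝ H u (v a)‖ ^ 2 := by
    intro a
    have h3 := abs_real_inner_le_norm (fderiv ℝ H u (v a)) (fderiv ℝ f u (v a))
    rw [hv.orthonormal.1 a, mul_one] at h3
    rw [← sq_abs]
    gcongr
  have h3 := sq_sum_le_card_mul_sum_sq (s := Finset.univ)
    (f := fun a => (inner ℝ (fderiv ℝ H u (v a)) (fderiv ℝ f u (v a)) : ℝ))
  rw [h1, Finset.card_univ, Fintype.card_fin] at h3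
  have hn' : (0 : ℝ) < n := by exact_mod_cast hn
  have h4 : (n : ℝ) * (n * ‖H u‖ ^ 4) ≤ n * ∑ a, ‖fderiv ℝ H u (v a)‖ ^ 2 :=
    calc (n : ℝ) * (n * ‖H u‖ ^ 4) = (-(n * ‖H u‖ ^ 2)) ^ 2 := by ring
      _ ≤ _ := h3
      _ ≤ _ := mul_le_mul_of_nonneg_left (Finset.sum_le_sum fun a _ => h2 a) hn'.le
  exact le_of_mul_le_mul_left h4 hn'

/-- The hypotheses give `2y² ≤ 28R² + 4yR`, hence `y ≤ (1 + √15)R`, and 5 is a convenient larger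
constant. The condition `1 ≤ m` absorbs the term `24r²`, so the bound is free of the dimension `m`.
-/
theorem bound_of_quadratic {R r m y h k : ℝ} (hR : 0 < R) (hm : 1 ≤ m) (hr : 0 ≤ r) (hrR : r ≤ R)
    (hy : y = (R ^ 2 - r ^ 2) * h) (hh : 0 ≤ h) (hk : k ≤ h * r)
    (hq : 2 * m * ((R ^ 2 - r ^ 2) ^ 2 * h ^ 2) ≤ 24 * r ^ 2 + 4 * m * (R ^ 2 - r ^ 2) * (1 + k)) :
    y ≤ 5 * R := by
  have hp : 0 ≤ R ^ 2 - r ^ 2 := by nlinarith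
  have h1 : (R ^ 2 - r ^ 2) * k ≤ y * R := by
    rw [hy]
    calc (R ^ 2 - r ^ 2) * k ≤ (R ^ 2 - r ^ 2) * (h * r) := by gcongr
      _ ≤ (R ^ 2 - r ^ 2) * (h * R) := by gcongr
      _ = _ := by ring
  have hr2 : r ^ 2 ≤ R ^ 2 := by gcongr
  have h2 : m * (2 * y ^ 2) ≤ m * (24 * R ^ 2 + 4 * (R ^ 2 + y * R)) := by
    calc m * (2 * y ^ 2) = 2 * m * ((R ^ 2 - r ^ 2) ^ 2 * h ^ 2) := by rw [hy]; ring
      _ ≤ 24 * r ^ 2 + 4 * m * (R ^ 2 - r ^ 2) * (1 + k) := hq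
      _ = 24 * r ^ 2 + m * (4 * ((R ^ 2 - r ^ 2) + (R ^ 2 - r ^ 2) * k)) := by ring
      _ ≤ m * (24 * R ^ 2) + m * (4 * (R ^ 2 + y * R)) := by
          have : 24 * r ^ 2 ≤ m * (24 * R ^ 2) := by nlinarith
          have h3 : (R ^ 2 - r ^ 2) + (R ^ 2 - r ^ 2) * k ≤ R ^ 2 + y * R := by nlinarith
          gcongr
      _ = _ := by ring
  have h3 := le_of_mul_le_mul_left h2 (by linarith)
  by_contra! hlt
  nlinarith [mul_pos hR (sub_pos.2 hlt), mul_self_pos.2 hR.ne']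

/-- The estimate at an interior maximum of `(R² - |f|²)² |H|²`. -/
theorem bound_of_isLocalMax (hn : 1 ≤ n) (hf : ImmersedOn f U) (hu : u ∈ U) {lam R : ℝ}
    (hlam : 0 ≤ lam) (hR : ‖f u‖ < R)
    (heq : inner ℝ (lap f (meanCurvatureLoc f) u) (meanCurvatureLoc f u)
      = lam * ‖meanCurvatureLoc f u‖ ^ 2)
    (hmax : IsLocalMax (fun w => (R ^ 2 - ‖f w‖ ^ 2) ^ 2 * ‖meanCurvatureLoc f w‖ ^ 2) u) :
    (R ^ 2 - ‖f u‖ ^ 2) * ‖meanCurvatureLoc f u‖ ≤ 5 * R := by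
  have hR0 : 0 < R := (norm_nonneg _).trans_lt hR
  have hinj := hf.injective u hu
  have hf2 := hf.contDiffAt hu
  have hH2 := contDiffAt_two hf.contDiffOn_meanCurvatureLoc hf.isOpen hu
  obtain ⟨v, c, hv⟩ := exists_isFrame hinj hf2
  have hcs := hv.norm_meanCurvatureLoc_pow_four_le hf hu
  have hlapH := hv.lap_inner hinj hf2 hH2
  have hlapf := hv.lap_inner hinj hf2 hf2
  rw [lap_self hinj hf2, inner_smul_left] at hlapf
  set H := meanCurvatureLoc f with hHdef
  by_cases hH0 : H u = 0
  · rw [hH0, norm_zero, mul_zero]; positivity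
  have hpos : 0 < ‖H u‖ ^ 2 := by positivity
  let φ : Euc n → ℝ := fun w => R ^ 2 - inner ℝ (f w) (f w)
  let Q : Euc n → ℝ := fun w => inner ℝ (H w) (H w)
  have hφ2 : ContDiffAt ℝ 2 φ u := contDiffAt_const.sub (hf2.inner ℝ hf2)
  have hQ2 : ContDiffAt ℝ 2 Q u := hH2.inner ℝ hH2
  have hφφ2 : ContDiffAt ℝ 2 (fun w => φ w * φ w) u := hφ2.mul hφ2
  have hφ1 := (hφ2.differentiableAt (by norm_num)).hasFDerivAt
  have hQ1 := (hQ2.differentiableAt (by norm_num)).hasFDerivAt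
  have hφφ1 : HasFDerivAt (fun w => φ w * φ w) (φ u • fderiv ℝ φ u + φ u • fderiv ℝ φ u) u :=
    hφ1.mul hφ1
  have hF1 : HasFDerivAt (fun w => φ w * φ w * Q w)
    ((φ u * φ u) • fderiv ℝ Q u + Q u • (φ u • fderiv ℝ φ u + φ u • fderiv ℝ φ u)) u :=
    hφφ1.mul hQ1
  have hmax' : IsLocalMax (fun w => (φ w * φ w) * Q w) u := by
    convert hmax using 2 with w
    simp only [φ, Q, real_inner_self_eq_norm_sq]; ring
  have hlapφ : lap f φ u = - (2 * (n * inner ℝ (H u) (f u)) + 2 * n) := by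
    rw [show φ = fun w => R ^ 2 - inner ℝ (f w) (f w) from rfl,
      lap_const_sub hinj hf2 (hf2.inner ℝ hf2), hlapf]
    simp [hv.orthonormal.1]
  have hφφ := hv.lap_bilin hinj hf2 (ContinuousLinearMap.mul ℝ ℝ) hφ2 hφ2
  have hF := hv.lap_bilin hinj hf2 (ContinuousLinearMap.mul ℝ ℝ) hφφ2 hQ2
  have hle := lap_nonpos_of_isLocalMax hinj hf2 (hφφ2.mul hQ2) hmax'
  have hcrit := hmax'.fderiv_eq_zero
  rw [hF1.fderiv] at hcrit
  simp only [ContinuousLinearMap.mul_apply'] at hφφ hF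
  rw [hφφ1.fderiv] at hF
  rw [hF, hφφ] at hle
  have hφpos : 0 < φ u := by
    simp only [φ, real_inner_self_eq_norm_sq]
    nlinarith [norm_nonneg (f u)]
  set p : Fin n → ℝ := fun a => fderiv ℝ φ u (v a) with hp
  set q : Fin n → ℝ := fun a => fderiv ℝ Q u (v a) with hq
  -- The derivative of `φ²Q` vanishes, and one factor `φ > 0` cancels.
  have hrel : ∀ a, φ u * q a = - 2 * Q u * p a := by
    intro a
    have h1 := congrArg (fun L => L (v a)) hcrit
    simp at h1
    have h2 : φ u * (φ u * q a + 2 * Q u * p a) = 0 := by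
      rw [← h1]; simp only [hp, hq]; ring
    have h3 := (mul_eq_zero.1 h2).resolve_left hφpos.ne'
    linarith
  have hpa : ∀ a, p a = - 2 * inner ℝ (fderiv ℝ f u (v a)) (f u) := by
    intro a
    have hd : DifferentiableAt ℝ f u := hf2.differentiableAt (by norm_num)
    simp only [hp, φ]
    rw [fderiv_const_sub, _root_.neg_apply, fderiv_inner_apply ℝ hd hd,
      real_inner_comm (f u)]
    ring
  -- Bessel's inequality for the orthonormal vectors `df(vₐ)`, since `dφ(vₐ) = -2⟨df(vₐ), f⟩`.
  have hS : ∑ a, p a * p a ≤ 4 * ‖f u‖ ^ 2 := by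
    have := hv.orthonormal.sum_inner_products_le (f u) (s := Finset.univ)
    calc ∑ a, p a * p a = 4 * ∑ a, ‖(inner ℝ (fderiv ℝ f u (v a)) (f u) : ℝ)‖ ^ 2 := by
          rw [Finset.mul_sum]
          refine Finset.sum_congr rfl fun a _ => ?_
          rw [hpa, Real.norm_eq_abs, sq_abs]; ring
      _ ≤ _ := by gcongr
  have hcross : ∑ a, (φ u • fderiv ℝ φ u + φ u • fderiv ℝ φ u) (v a) * fderiv ℝ Q u (v a)
      = - 4 * Q u * ∑ a, p a * p a := by
    rw [Finset.mul_sum]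
    refine Finset.sum_congr rfl fun a _ => ?_
    have : (φ u • fderiv ℝ φ u + φ u • fderiv ℝ φ u) (v a) * fderiv ℝ Q u (v a)
        = 2 * p a * (φ u * q a) := by
      simp [hp, hq]; ring
    rw [this, hrel]; ring
  rw [hcross] at hle
  have hlapQ : 2 * n * ‖H u‖ ^ 4 ≤ lap f Q u := by
    rw [show Q = fun w => inner ℝ (H w) (H w) from rfl, hlapH, heq]
    nlinarith [mul_nonneg hlam hpos.le]
  have hQu : Q u = ‖H u‖ ^ 2 := real_inner_self_eq_norm_sq _
  have hφu : φ u = R ^ 2 - ‖f u‖ ^ 2 := by simp only [φ, real_inner_self_eq_norm_sq]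
  -- The condition `Δ(φ²Q) ≤ 0` contains `2Q|dφ|²` from `Δ(φ²)` and `-8Q|dφ|²` from the cross term,
  -- together `-6Q|dφ|²`. With `|dφ|² ≤ 4|f|²` this gives the constant 24; `-2QφΔφ` gives the other
  -- term.
  have hfin : ‖H u‖ ^ 2 * (2 * n * ((R ^ 2 - ‖f u‖ ^ 2) ^ 2 * ‖H u‖ ^ 2))
      ≤ ‖H u‖ ^ 2 * (24 * ‖f u‖ ^ 2 + 4 * n * (R ^ 2 - ‖f u‖ ^ 2) * (1 + inner ℝ (H u) (f u))) := by
    have h1 : φ u * φ u * (2 * n * ‖H u‖ ^ 4) ≤ φ u * φ u * lap f Q u := by gcongr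
    have h2 : ‖H u‖ ^ 2 * (6 * ∑ a, p a * p a) ≤ ‖H u‖ ^ 2 * (6 * (4 * ‖f u‖ ^ 2)) := by gcongr
    rw [← hφu]
    rw [hlapφ, hQu] at hle
    simp only [smul_eq_mul] at hle
    have h3 : φ u * φ u * lap f Q u ≤ ‖H u‖ ^ 2 * (6 * ∑ a, p a * p a)
        + ‖H u‖ ^ 2 * (4 * n * φ u * (1 + inner ℝ (H u) (f u))) := by
      have hpp : ∑ a, fderiv ℝ φ u (v a) * fderiv ℝ φ u (v a) = ∑ a, p a * p a := rfl
      rw [hpp] at hle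
      linarith
    linarith
  have hfin' := le_of_mul_le_mul_left hfin hpos
  refine bound_of_quadratic hR0 (by exact_mod_cast hn) (norm_nonneg _) hR.le rfl (norm_nonneg _)
    ?_ hfin'
  exact real_inner_le_norm _ _

end MaximumPrinciple

/-! ### From charts to the manifold: independence of the chart and the global bound -/

section Charts

variable {n N : ℕ} {M : Type*} [TopologicalSpace M] [ChartedSpace (Euc n) M]
  [IsManifold (𝓡 n) ∞ M] {x : M → Euc N} {e e' : OpenPartialHomeomorph M (Euc n)} {u : Euc n}
  {p : M}

theorem ContMDiff.contDiffOn_comp_symm {φ : M → Euc N}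
    (hφ : ContMDiff (𝓡 n) 𝓘(ℝ, Euc N) ∞ φ) (he : e ∈ atlas (Euc n) M) :
    ContDiffOn ℝ ∞ (φ ∘ e.symm) e.target :=
  contMDiffOn_iff_contDiffOn.1 (hφ.comp_contMDiffOn
    (contMDiffOn_symm_of_mem_maximalAtlas (IsManifold.subset_maximalAtlas he)))

theorem IsSmoothImmersion.immersedOn (hx : IsSmoothImmersion (n := n) x)
    (he : e ∈ atlas (Euc n) M) : ImmersedOn (x ∘ e.symm) e.target := by
  refine ⟨e.open_target, ContMDiff.contDiffOn_comp_symm hx.1 he, fun u hu => ?_⟩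
  have h1 : e.MDifferentiable (𝓡 n) (𝓡 n) := mdifferentiable_of_mem_atlas he
  rw [← mfderiv_eq_fderiv, mfderiv_comp u ((hx.1.mdifferentiable (by simp)) (e.symm u))
    (h1.symm.mdifferentiableAt hu)]
  exact (hx.2 _).comp (h1.symm.mfderiv_injective hu)

theorem contDiffOn_transition (he : e ∈ atlas (Euc n) M) (he' : e' ∈ atlas (Euc n) M) :
    ContDiffOn ℝ ∞ (e ∘ e'.symm) (e'.target ∩ e'.symm ⁻¹' e.source) := by
  refine contMDiffOn_iff_contDiffOn.1 ?_
  exact (contMDiffOn_of_mem_maximalAtlas (IsManifold.subset_maximalAtlas he)).comp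
    ((contMDiffOn_symm_of_mem_maximalAtlas (I := 𝓡 n) (n := ∞)
      (IsManifold.subset_maximalAtlas he')).mono inter_subset_left) fun w hw => hw.2

omit [ChartedSpace (Euc n) M] [IsManifold (𝓡 n) ∞ M] in
theorem isOpen_transition_source (e e' : OpenPartialHomeomorph M (Euc n)) :
    IsOpen (e'.target ∩ e'.symm ⁻¹' e.source) :=
  e'.symm.isOpen_inter_preimage e.open_source

theorem bijective_fderiv_transition (he : e ∈ atlas (Euc n) M) (he' : e' ∈ atlas (Euc n) M)
    (hu : u ∈ e'.target) (hu' : e'.symm u ∈ e.source) :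
    Function.Bijective (fderiv ℝ (e ∘ e'.symm) u) := by
  have h1 : e.MDifferentiable (𝓡 n) (𝓡 n) := mdifferentiable_of_mem_atlas he
  have h2 : e'.MDifferentiable (𝓡 n) (𝓡 n) := mdifferentiable_of_mem_atlas he'
  have h3 := (h2.symm.trans h1).mfderiv_bijective (x := u) (by simp [hu, hu'])
  rw [mfderiv_eq_fderiv] at h3
  exact h3

omit [ChartedSpace (Euc n) M] [IsManifold (𝓡 n) ∞ M] in
theorem comp_symm_eventuallyEq_transition {W : Type*} (F : M → W)
    (hu : u ∈ e'.target) (hu' : e'.symm u ∈ e.source) :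
    F ∘ e'.symm =ᶠ[𝓝 u] (F ∘ e.symm) ∘ (e ∘ e'.symm) := by
  filter_upwards [(isOpen_transition_source e e').mem_nhds ⟨hu, hu'⟩] with w hw
  simp [e.left_inv hw.2]

theorem normSqDiffLoc_congr {f f' φ φ' : Euc n → Euc N} (hf : f =ᶠ[𝓝 u] f')
    (hφ : φ =ᶠ[𝓝 u] φ') : normSqDiffLoc f φ u = normSqDiffLoc f' φ' u := by
  have hm : metric f u = metric f' u := by
    ext i j; simp [metric, (pd_congr hf _).self_of_nhds]
  simp only [normSqDiffLoc, metricInv, hm, (pd_congr hφ _).self_of_nhds]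

variable (hx : IsSmoothImmersion (n := n) x)
include hx

theorem lap_chart_change {W : Type*} [NormedAddCommGroup W] [NormedSpace ℝ W]
    (he : e ∈ atlas (Euc n) M) (he' : e' ∈ atlas (Euc n) M)
    (hu : u ∈ e'.target) (hu' : e'.symm u ∈ e.source) {F : M → W}
    (hF : ContDiffAt ℝ 2 (F ∘ e.symm) (e (e'.symm u))) :
    lap (x ∘ e'.symm) (F ∘ e'.symm) u = lap (x ∘ e.symm) (F ∘ e.symm) (e (e'.symm u)) := by
  have h := hx.immersedOn he
  rw [lap_congr (comp_symm_eventuallyEq_transition x hu hu')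
    (comp_symm_eventuallyEq_transition F hu hu')]
  exact lap_comp (ψ := e ∘ e'.symm) (h.contDiffAt (e.map_source hu'))
    (contDiffAt_two (contDiffOn_transition he he') (isOpen_transition_source e e') ⟨hu, hu'⟩)
    (h.injective _ (e.map_source hu')) (bijective_fderiv_transition he he' hu hu') hF

/-- By definition `tension` is computed at each point in that point's own chart. Differentiation and
integration need one fixed chart `e` for all points of its domain. -/
theorem tension_eq (he : e ∈ atlas (Euc n) M) (hp : p ∈ e.source) {φ : M → Euc N}
    (hφ : ContDiffAt ℝ 2 (φ ∘ e.symm) (e p)) :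
    tension (n := n) x φ p = lap (x ∘ e.symm) (φ ∘ e.symm) (e p) := by
  have h := lap_chart_change hx he (chart_mem_atlas (Euc n) p) (u := chartAt (Euc n) p p)
    (F := φ) (mem_chart_target _ _)
  simp only [mem_chart_source, OpenPartialHomeomorph.left_inv] at h
  exact h hp hφ

theorem normSqDiff_eq (he : e ∈ atlas (Euc n) M) (hp : p ∈ e.source) {φ : M → Euc N}
    (hφ : ContDiffAt ℝ 2 (φ ∘ e.symm) (e p)) :
    normSqDiff (n := n) x φ p = normSqDiffLoc (x ∘ e.symm) (φ ∘ e.symm) (e p) := by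
  have hs : (chartAt (Euc n) p).symm (chartAt (Euc n) p p) = p := by simp
  have hu : chartAt (Euc n) p p ∈ (chartAt (Euc n) p).target := mem_chart_target _ _
  have hu' : (chartAt (Euc n) p).symm (chartAt (Euc n) p p) ∈ e.source := by rwa [hs]
  have he' := chart_mem_atlas (Euc n) p
  have h := hx.immersedOn he
  have hψ : (e ∘ (chartAt (Euc n) p).symm) (chartAt (Euc n) p p) = e p := by simp
  refine (normSqDiffLoc_congr (comp_symm_eventuallyEq_transition x hu hu')
    (comp_symm_eventuallyEq_transition φ hu hu')).trans ?_
  rw [normSqDiffLoc_comp, hψ]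
  · rw [hψ]; exact h.contDiffAt (e.map_source hp)
  · exact contDiffAt_two (contDiffOn_transition he he') (isOpen_transition_source e _) ⟨hu, hu'⟩
  · rw [hψ]; exact h.injective _ (e.map_source hp)
  · exact bijective_fderiv_transition he he' hu hu'
  · rwa [hψ]

theorem meanCurvature_eq_smul_tension (p : M) :
    meanCurvature (n := n) x p = (1 / (n : ℝ)) • tension (n := n) x x p := by
  have h := hx.immersedOn (chart_mem_atlas (Euc n) p)
  exact meanCurvatureLoc_eq (h.injective _ (mem_chart_target _ _))
    (h.contDiffAt (mem_chart_target _ _))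

theorem meanCurvature_eq (he : e ∈ atlas (Euc n) M) (hp : p ∈ e.source) :
    meanCurvature (n := n) x p = meanCurvatureLoc (x ∘ e.symm) (e p) := by
  have h := hx.immersedOn he
  have hp' := e.map_source hp
  rw [meanCurvature_eq_smul_tension hx, tension_eq hx he hp (h.contDiffAt hp'),
    meanCurvatureLoc_eq (h.injective _ hp') (h.contDiffAt hp')]

theorem meanCurvature_comp_symm (he : e ∈ atlas (Euc n) M) (hu : u ∈ e.target) :
    (meanCurvature (n := n) x ∘ e.symm) u = meanCurvatureLoc (x ∘ e.symm) u := by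
  rw [Function.comp_apply, meanCurvature_eq hx he (e.map_target hu), e.right_inv hu]

theorem contDiffOn_meanCurvature_comp_symm (he : e ∈ atlas (Euc n) M) :
    ContDiffOn ℝ ∞ (meanCurvature (n := n) x ∘ e.symm) e.target :=
  (hx.immersedOn he).contDiffOn_meanCurvatureLoc.congr fun _ hu => meanCurvature_comp_symm hx he hu

theorem continuous_meanCurvature : Continuous (meanCurvature (n := n) x) := by
  refine continuous_iff_continuousAt.2 fun p => ?_
  have he := chart_mem_atlas (Euc n) p
  have h1 : ContinuousAt (meanCurvatureLoc (x ∘ (chartAt (Euc n) p).symm))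
      (chartAt (Euc n) p p) :=
    (contDiffAt_two (hx.immersedOn he).contDiffOn_meanCurvatureLoc
      (chartAt (Euc n) p).open_target (mem_chart_target _ _)).continuousAt
  have h2 := h1.comp ((chartAt (Euc n) p).continuousAt (mem_chart_source _ _))
  refine h2.congr ?_
  filter_upwards [(chartAt (Euc n) p).open_source.mem_nhds (mem_chart_source _ _)] with q hq
  exact (meanCurvature_eq hx he hq).symm

/-- The normal biminimal equation in the form that enters the maximum principle. -/
theorem inner_tension_meanCurvature_of_biminimalEquation {lam : ℝ}
    (h : BiminimalEquation n x lam) (p : M) :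
    inner ℝ (tension (n := n) x (meanCurvature (n := n) x) p) (meanCurvature (n := n) x p)
      = lam * ‖meanCurvature (n := n) x p‖ ^ 2 := by
  have he := chart_mem_atlas (Euc n) p
  have hf := hx.immersedOn he
  have h1 := inner_normalLaplacianLoc_sub hf (contDiffOn_meanCurvature_comp_symm hx he)
    (fun w hw j => by
      rw [meanCurvature_comp_symm hx he hw]
      exact inner_meanCurvatureLoc_pd (hf.injective w hw) j) (mem_chart_target _ p)
  have h2 : (meanCurvature (n := n) x ∘ (chartAt (Euc n) p).symm) (chartAt (Euc n) p p)
      = meanCurvature (n := n) x p := by simp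
  rw [h2] at h1
  refine h1.symm.trans ?_
  have h3 := congrArg (fun w => (inner ℝ w (meanCurvature (n := n) x p) : ℝ)) (h p)
  rw [inner_smul_left, real_inner_self_eq_norm_sq] at h3
  exact h3

/-- The square root of the maximized function is the left-hand side, so it suffices to bound it at a
maximum point `q` over the compact preimage of the closed ball. -/
theorem bound_meanCurvature (hproper : IsProperMap x) {lam : ℝ} (hlam : 0 ≤ lam) (hn : 1 ≤ n)
    (heq : ∀ p : M, inner ℝ (tension (n := n) x (meanCurvature (n := n) x) p)
      (meanCurvature (n := n) x p) = lam * ‖meanCurvature (n := n) x p‖ ^ 2)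
    {R : ℝ} (p : M) (hp : ‖x p‖ < R) :
    (R ^ 2 - ‖x p‖ ^ 2) * ‖meanCurvature (n := n) x p‖ ≤ 5 * R := by
  have hR : 0 < R := (norm_nonneg _).trans_lt hp
  let H := meanCurvature (n := n) x
  let F : M → ℝ := fun q => (R ^ 2 - ‖x q‖ ^ 2) ^ 2 * ‖H q‖ ^ 2
  have hxc : Continuous x := hx.1.continuous
  have hFc : Continuous F := by
    have := continuous_meanCurvature hx
    fun_prop
  have hK : IsCompact (x ⁻¹' Metric.closedBall 0 R) :=
    hproper.isCompact_preimage (isCompact_closedBall _ _)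
  obtain ⟨q, hqK, hq⟩ := hK.exists_isMaxOn ⟨p, by simpa using hp.le⟩ hFc.continuousOn
  have hpF : F p ≤ F q := hq (by simpa using hp.le)
  have hqR : ‖x q‖ ≤ R := by simpa using hqK
  have hsqp : 0 ≤ R ^ 2 - ‖x p‖ ^ 2 := by nlinarith [norm_nonneg (x p)]
  have hsqq : 0 ≤ R ^ 2 - ‖x q‖ ^ 2 := by nlinarith [norm_nonneg (x q)]
  have hle : (R ^ 2 - ‖x p‖ ^ 2) * ‖H p‖ ≤ (R ^ 2 - ‖x q‖ ^ 2) * ‖H q‖ := by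
    refine le_of_sq_le_sq ?_ (by positivity)
    simpa only [mul_pow] using hpF
  refine hle.trans ?_
  -- On the sphere `|x| = R` the weight vanishes. Otherwise `q` lies in the open preimage of the
  -- open ball and is a true local maximum.
  rcases hqR.eq_or_lt with hqR | hqR
  · rw [hqR, sub_self, zero_mul]; positivity
  have he := chart_mem_atlas (Euc n) q
  have hf := hx.immersedOn he
  set e := chartAt (Euc n) q with he_def
  have hu : e q ∈ e.target := mem_chart_target _ _
  have hs : e.symm (e q) = q := e.left_inv (mem_chart_source _ _)
  have hHq : meanCurvatureLoc (x ∘ e.symm) (e q) = H q := rfl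
  have hev : e.target ∈ 𝓝 (e q) := e.open_target.mem_nhds hu
  have hmax : IsLocalMax F q := by
    have : x ⁻¹' Metric.ball 0 R ∈ 𝓝 q :=
      hxc.continuousAt.preimage_mem_nhds (Metric.isOpen_ball.mem_nhds (by simpa using hqR))
    filter_upwards [this] with w hw
    exact hq (preimage_mono Metric.ball_subset_closedBall hw)
  have hmax' : IsLocalMax (fun w => (R ^ 2 - ‖(x ∘ e.symm) w‖ ^ 2) ^ 2
      * ‖meanCurvatureLoc (x ∘ e.symm) w‖ ^ 2) (e q) := by
    have hc : Filter.Tendsto e.symm (𝓝 (e q)) (𝓝 q) := by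
      have := e.continuousAt_symm hu
      rwa [ContinuousAt, hs] at this
    filter_upwards [hc.eventually hmax, hev] with w hw hw'
    rw [← meanCurvature_comp_symm hx he hw', ← meanCurvature_comp_symm hx he hu]
    simp only [Function.comp_apply, hs]
    exact hw
  have h1 := heq q
  rw [tension_eq hx he (mem_chart_source _ _)
    (contDiffAt_two (contDiffOn_meanCurvature_comp_symm hx he) e.open_target hu),
    lap_congr (Filter.EventuallyEq.refl _ _) (Filter.mem_of_superset hev
      fun w hw => meanCurvature_comp_symm hx he hw)] at h1
  have := bound_of_isLocalMax hn hf hu hlam (R := R) (by simpa [hs] using hqR) h1 hmax'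
  rwa [hHq, Function.comp_apply, hs] at this

theorem meanCurvature_eq_zero (hproper : IsProperMap x) {lam : ℝ} (hlam : 0 ≤ lam) (hn : 1 ≤ n)
    (heq : ∀ p : M, inner ℝ (tension (n := n) x (meanCurvature (n := n) x) p)
      (meanCurvature (n := n) x p) = lam * ‖meanCurvature (n := n) x p‖ ^ 2) (p : M) :
    meanCurvature (n := n) x p = 0 := by
  by_contra hne
  set h := ‖meanCurvature (n := n) x p‖ with hdef
  have hh : 0 < h := norm_pos_iff.2 hne
  set r := ‖x p‖
  have hr : 0 ≤ r := norm_nonneg _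
  -- This `R` satisfies `R ≥ 2r`, so `R² - r² ≥ ¾R²`, and `Rh > 10`. The bound would give `¾Rh ≤ 5`,
  -- which is impossible.
  have h1 := bound_meanCurvature hx hproper hlam hn heq p (R := 2 * r + 1 + 10 / h) (by
    have : 0 < 10 / h := by positivity
    linarith)
  set R := 2 * r + 1 + 10 / h with hR
  have hd : 10 / h * h = 10 := by field_simp
  have hd0 : 0 < 10 / h := by positivity
  have h2 : 10 < R * h := by nlinarith
  have h3 : 4 * r ^ 2 ≤ R ^ 2 := by nlinarith
  have h4 : R * (R * h) * (3 / 4) ≤ (R ^ 2 - r ^ 2) * h := by nlinarith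
  nlinarith

end Charts

/-! ### The Laplacian in divergence form and Green's formula -/

section Divergence

variable {n N : ℕ} {f : Euc n → Euc N} {U : Set (Euc n)} {u : Euc n}

/-- Jacobi's formula: the Leibniz expansion is differentiated column by column, and the determinant
with one column replaced is expressed through the adjugate by Cramer's rule. -/
theorem hasFDerivAt_det {E : Type*} [NormedAddCommGroup E] [NormedSpace ℝ E] {z : E}
    {A : E → Matrix (Fin n) (Fin n) ℝ} {A' : Fin n → Fin n → E →L[ℝ] ℝ}
    (hA : ∀ a b, HasFDerivAt (fun w => A w a b) (A' a b) z) :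
    HasFDerivAt (fun w => (A w).det) (∑ b, ∑ a, (A z).adjugate b a • A' a b) z := by
  have h1 : HasFDerivAt (fun w => (A w).det) (∑ σ : Equiv.Perm (Fin n),
      ((Equiv.Perm.sign σ : ℤ) : ℝ) • ∑ i, (∏ j ∈ Finset.univ.erase i, A z (σ j) j) •
        A' (σ i) i) z := by
    simp only [Matrix.det_apply']
    exact HasFDerivAt.fun_sum fun σ _ =>
      (HasFDerivAt.finsetProd fun i _ => hA (σ i) i).const_mul _
  convert h1 using 1
  ext v
  simp only [_root_.sum_apply, _root_.smul_apply, smul_eq_mul, Finset.mul_sum]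
  rw [Finset.sum_comm (γ := Equiv.Perm (Fin n))]
  refine Finset.sum_congr rfl fun b _ => ?_
  have h2 : ∑ a, (A z).adjugate b a * A' a b v
      = ((A z).updateCol b fun a => A' a b v).det := by
    rw [← Matrix.cramer_apply, Matrix.cramer_eq_adjugate_mulVec]
    rfl
  rw [h2, Matrix.det_apply']
  refine Finset.sum_congr rfl fun σ _ => ?_
  rw [← Finset.prod_erase_mul _ _ (Finset.mem_univ b), Matrix.updateCol_self]
  congr 2
  refine Finset.prod_congr rfl fun j hj => ?_
  rw [Matrix.updateCol_ne (Finset.ne_of_mem_erase hj)]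

/-- The derivative `∂ᵢ g_{ab}`. -/
abbrev dMetric (f : Euc n → Euc N) (u : Euc n) (i a b : Fin n) : ℝ :=
  pd i (fun w => metric f w a b) u

namespace ImmersedOn

theorem differentiableAt_metric (hf : ImmersedOn f U) (hu : u ∈ U) (a b : Fin n) :
    DifferentiableAt ℝ (fun w => metric f w a b) u :=
  (contDiffAt_two (hf.contDiffOn_metric a b) hf.isOpen hu).differentiableAt (by norm_num)

theorem differentiableAt_metricInv (hf : ImmersedOn f U) (hu : u ∈ U) (a b : Fin n) :
    DifferentiableAt ℝ (fun w => metricInv f w a b) u :=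
  (contDiffAt_two (hf.contDiffOn_metricInv a b) hf.isOpen hu).differentiableAt (by norm_num)

theorem pd_sqrt_det_metric (hf : ImmersedOn f U) (hu : u ∈ U) (i : Fin n) :
    pd i (fun w => √(metric f w).det) u
      = √(metric f u).det * (1 / 2 * ∑ k, ∑ l, metricInv f u k l * dMetric f u i k l) := by
  have hpos := det_metric_pos (hf.injective u hu)
  have h1 := hasFDerivAt_det (A := metric f) (z := u)
    fun a b => (hf.differentiableAt_metric hu a b).hasFDerivAt
  have h2 := (h1.sqrt hpos.ne').fderiv
  unfold pd
  rw [h2]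
  have h3 : (metric f u).adjugate = (metric f u).det • metricInv f u := by
    rw [metricInv, Matrix.inv_def, smul_smul, Ring.inverse_eq_inv', mul_inv_cancel₀ hpos.ne',
      one_smul]
  have h4 : (metric f u).det = √(metric f u).det * √(metric f u).det :=
    (Real.mul_self_sqrt hpos.le).symm
  have h5 : √(metric f u).det ≠ 0 := (Real.sqrt_pos.2 hpos).ne'
  simp only [_root_.sum_apply, _root_.smul_apply, smul_eq_mul, h3, Matrix.smul_apply, mul_assoc,
    ← Finset.mul_sum]
  have h6 : ∑ b, ∑ a, metricInv f u b a * (fderiv ℝ (fun w => metric f w a b) u)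
      (EuclideanSpace.single i 1) = ∑ k, ∑ l, metricInv f u k l * dMetric f u i k l := by
    refine Finset.sum_congr rfl fun k _ => Finset.sum_congr rfl fun l _ => ?_
    rw [show (fun w => metric f w l k) = fun w => metric f w k l from
      funext fun w => metric_symm f w l k]
    rfl
  rw [h6]
  set s := √(metric f u).det
  rw [h4]
  field_simp

/-- Differentiate `g⁻¹ g = 1` near `u` and multiply by `g⁻¹` on the right. -/
theorem pd_metricInv (hf : ImmersedOn f U) (hu : u ∈ U) (i a j : Fin n) :
    pd i (fun w => metricInv f w a j) u
      = - ∑ b, ∑ c, metricInv f u a b * dMetric f u i b c * metricInv f u c j := by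
  have h1 : ∀ c, ∑ b, (pd i (fun w => metricInv f w a b) u * metric f u b c
      + metricInv f u a b * dMetric f u i b c) = 0 := by
    intro c
    have h2 : (fun w => ∑ b, metricInv f w a b * metric f w b c) =ᶠ[𝓝 u]
        fun _ => (1 : Matrix (Fin n) (Fin n) ℝ) a c := by
      filter_upwards [hf.isOpen.mem_nhds hu] with w hw
      rw [← metricInv_mul (hf.injective w hw), Matrix.mul_apply]
    have h3 : HasFDerivAt (fun w => ∑ b, metricInv f w a b * metric f w b c) _ u :=
      HasFDerivAt.fun_sum (u := Finset.univ) fun b _ =>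
        (hf.differentiableAt_metricInv hu a b).hasFDerivAt.mul
          (hf.differentiableAt_metric hu b c).hasFDerivAt
    have h4 := h3.fderiv
    rw [h2.fderiv_eq] at h4
    have h5 := congrArg (fun L => L (cvec i)) h4
    simp only [_root_.sum_apply, _root_.smul_apply, _root_.add_apply, smul_eq_mul,
      fderiv_fun_const, Pi.zero_apply, _root_.zero_apply] at h5
    rw [h5]
    refine Finset.sum_congr rfl fun b _ => ?_
    simp only [pd]; ring
  have h2 : ∀ b, ∑ c, metric f u b c * metricInv f u c j = if b = j then 1 else 0 := by
    intro b
    rw [← Matrix.mul_apply, metric_mul_metricInv (hf.injective u hu), Matrix.one_apply]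
  have h3 : ∑ c, (∑ b, (pd i (fun w => metricInv f w a b) u * metric f u b c
      + metricInv f u a b * dMetric f u i b c)) * metricInv f u c j = 0 := by
    simp [h1]
  simp only [Finset.sum_mul, add_mul, Finset.sum_add_distrib] at h3
  rw [Finset.sum_comm, Finset.sum_comm (f := fun c b => metricInv f u a b * _ * _)] at h3
  simp only [mul_assoc, ← Finset.mul_sum, h2] at h3
  simp only [mul_assoc, ← Finset.mul_sum]
  simp at h3
  linarith

theorem sum_pd_sqrt_det_mul_metricInv (hf : ImmersedOn f U) (hu : u ∈ U) (j : Fin n) :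
    ∑ i, pd i (fun w => √(metric f w).det * metricInv f w i j) u
      = - (√(metric f u).det * ∑ k, ∑ l, metricInv f u k l * christoffel f j k l u) := by
  have hw : DifferentiableAt ℝ (fun w => √(metric f w).det) u :=
    (contDiffAt_two hf.contDiffOn_sqrt_det_metric hf.isOpen hu).differentiableAt (by norm_num)
  have h1 : ∀ i, pd i (fun w => √(metric f w).det * metricInv f w i j) u
      = √(metric f u).det * (1 / 2 * (∑ k, ∑ l, metricInv f u k l * dMetric f u i k l)
          * metricInv f u i j
        - ∑ b, ∑ c, metricInv f u i b * dMetric f u i b c * metricInv f u c j) := by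
    intro i
    have h2 := (hw.hasFDerivAt.mul (hf.differentiableAt_metricInv hu i j).hasFDerivAt).fderiv
    have h3 : pd i (fun w => √(metric f w).det * metricInv f w i j) u
        = √(metric f u).det * pd i (fun w => metricInv f w i j) u
          + metricInv f u i j * pd i (fun w => √(metric f w).det) u :=
      congrArg (fun L => L (cvec i)) h2
    rw [h3, hf.pd_metricInv hu, hf.pd_sqrt_det_metric hu]
    ring
  set I := metricInv f u
  set D := dMetric f u
  have hI : ∀ a b, I a b = I b a := metricInv_symm f u
  -- Up to symmetry, `S` and `T` are the only contractions of `∂g` that occur. Divided by `√(det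
  -- g)`, the left side is `½S - T` and the right side is `-½(2T - S)`.
  let S : ℝ := ∑ k, ∑ l, ∑ m, I k l * I j m * D m k l
  let T : ℝ := ∑ k, ∑ l, ∑ m, I k l * I j m * D k l m
  have hT' : ∑ k, ∑ l, ∑ m, I k l * I j m * D l k m = T := by
    rw [Finset.sum_comm]
    refine Finset.sum_congr rfl fun l _ => Finset.sum_congr rfl fun k _ => ?_
    rw [hI]
  have hR : ∑ k, ∑ l, I k l * christoffel f j k l u = 1 / 2 * (T + T - S) := by
    have h2 : ∀ k l, I k l * christoffel f j k l u = 1 / 2 * ((∑ m, I k l * I j m * D k l m)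
        + (∑ m, I k l * I j m * D l k m) - ∑ m, I k l * I j m * D m k l) := by
      intro k l
      rw [← Finset.sum_add_distrib, ← Finset.sum_sub_distrib, christoffel, Finset.mul_sum,
        Finset.mul_sum, Finset.mul_sum]
      refine Finset.sum_congr rfl fun m _ => ?_
      simp only [I, D, dMetric]
      ring
    simp only [h2, ← Finset.mul_sum, Finset.sum_sub_distrib, Finset.sum_add_distrib, hT']
    rfl
  have hS : ∑ i, (∑ k, ∑ l, I k l * D i k l) * I i j = S := by
    simp only [Finset.sum_mul, S]
    rw [Finset.sum_comm]
    refine Finset.sum_congr rfl fun k _ => ?_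
    rw [Finset.sum_comm]
    refine Finset.sum_congr rfl fun l _ => Finset.sum_congr rfl fun m _ => ?_
    rw [hI m j]; ring
  have hT : ∑ i, ∑ b, ∑ c, I i b * D i b c * I c j = T := by
    refine Finset.sum_congr rfl fun k _ => Finset.sum_congr rfl fun l _ =>
      Finset.sum_congr rfl fun m _ => ?_
    rw [hI m j]; ring
  simp only [h1]
  rw [← Finset.mul_sum, Finset.sum_sub_distrib, hT]
  simp only [← Finset.mul_sum, mul_assoc, hS, hR]
  ring

/-- The field `√(det g) ∑ g^{ij} (⟨a, ∂ⱼ b⟩ - ⟨∂ⱼ a, b⟩)` of Green's formula. -/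
def _root_.BiminimalSubmanifold.greenField (f a b : Euc n → Euc N) (i : Fin n) (u : Euc n) : ℝ :=
  ∑ j, √(metric f u).det * metricInv f u i j
    * ((inner ℝ (a u) (pd j b u) : ℝ) - inner ℝ (pd j a u) (b u))

/-- Derivatives of the weights `√(det g) g^{ij}` produce the Christoffel terms of the two
Laplacians, second derivatives produce the leading terms, and the products of first derivatives
(`h4`) cancel by symmetry of `g^{ij}`. -/
theorem sum_pd_greenField (hf : ImmersedOn f U) (hu : u ∈ U) {a b : Euc n → Euc N}
    (ha : ContDiffAt ℝ 2 a u) (hb : ContDiffAt ℝ 2 b u) :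
    ∑ i, pd i (greenField f a b i) u
      = ((inner ℝ (a u) (lap f b u) : ℝ) - inner ℝ (lap f a u) (b u)) * √(metric f u).det := by
  have ha1 : DifferentiableAt ℝ a u := ha.differentiableAt (by norm_num)
  have hb1 : DifferentiableAt ℝ b u := hb.differentiableAt (by norm_num)
  have hw : DifferentiableAt ℝ (fun w => √(metric f w).det) u :=
    (contDiffAt_two hf.contDiffOn_sqrt_det_metric hf.isOpen hu).differentiableAt (by norm_num)
  let D : Fin n → Euc n → ℝ := fun j w => (inner ℝ (a w) (pd j b w) : ℝ) - inner ℝ (pd j a w) (b w)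
  have hDd : ∀ j, DifferentiableAt ℝ (D j) u := fun j =>
    (ha1.inner ℝ (differentiableAt_pd hb j)).sub ((differentiableAt_pd ha j).inner ℝ hb1)
  have hD : ∀ i j, pd i (D j) u = (inner ℝ (pd i a u) (pd j b u) - inner ℝ (pd j a u) (pd i b u))
      + (inner ℝ (a u) (pd i (pd j b) u) - inner ℝ (pd i (pd j a) u) (b u)) := by
    intro i j
    have h1 : pd i (D j) u = pd i (fun w => (inner ℝ (a w) (pd j b w) : ℝ)) u
        - pd i (fun w => (inner ℝ (pd j a w) (b w) : ℝ)) u := by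
      have := (ha1.inner ℝ (differentiableAt_pd hb j)).hasFDerivAt.sub
        ((differentiableAt_pd ha j).inner ℝ hb1).hasFDerivAt
      exact congrArg (fun L => L (cvec i)) this.fderiv
    rw [h1, pd_inner ha1 (differentiableAt_pd hb j), pd_inner (differentiableAt_pd ha j) hb1]
    ring
  have h1 : ∀ i, pd i (greenField f a b i) u
      = ∑ j, (pd i (fun w => √(metric f w).det * metricInv f w i j) u * D j u
        + √(metric f u).det * metricInv f u i j * pd i (D j) u) := by
    intro i
    have h2 : HasFDerivAt (greenField f a b i) _ u :=
      HasFDerivAt.fun_sum (u := Finset.univ) fun j _ =>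
        (hw.fun_mul (hf.differentiableAt_metricInv hu i j)).hasFDerivAt.mul (hDd j).hasFDerivAt
    unfold pd
    rw [h2.fderiv]
    simp only [_root_.sum_apply, _root_.smul_apply, _root_.add_apply, smul_eq_mul]
    refine Finset.sum_congr rfl fun j _ => ?_
    simp only [D]
    ring
  simp only [h1, Finset.sum_add_distrib]
  have h3 : ∑ i, ∑ j, pd i (fun w => √(metric f w).det * metricInv f w i j) u * D j u
      = - (√(metric f u).det
        * ∑ k, ∑ l, metricInv f u k l * ∑ j, christoffel f j k l u * D j u) := by
    rw [Finset.sum_comm]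
    simp only [← Finset.sum_mul, hf.sum_pd_sqrt_det_mul_metricInv hu]
    simp only [neg_mul, Finset.sum_neg_distrib, mul_assoc, Finset.mul_sum, Finset.sum_mul]
    congr 1
    rw [Finset.sum_comm]
    refine Finset.sum_congr rfl fun k _ => ?_
    rw [Finset.sum_comm]
  have h4 : ∑ i, ∑ j, metricInv f u i j
      * ((inner ℝ (pd i a u) (pd j b u) : ℝ) - inner ℝ (pd j a u) (pd i b u)) = 0 := by
    simp only [mul_sub, Finset.sum_sub_distrib]
    rw [sub_eq_zero, Finset.sum_comm]
    refine Finset.sum_congr rfl fun i _ => Finset.sum_congr rfl fun j _ => ?_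
    rw [metricInv_symm]
  have h5 : (inner ℝ (a u) (lap f b u) : ℝ) - inner ℝ (lap f a u) (b u)
      = ∑ i, ∑ j, metricInv f u i j * ((inner ℝ (a u) (pd i (pd j b) u) : ℝ)
          - inner ℝ (pd i (pd j a) u) (b u))
        - ∑ k, ∑ l, metricInv f u k l * ∑ j, christoffel f j k l u * D j u := by
    simp only [lap, inner_sum, sum_inner, inner_smul_left, inner_smul_right, inner_sub_left,
      inner_sub_right, ← Finset.sum_sub_distrib]
    refine Finset.sum_congr rfl fun i _ => Finset.sum_congr rfl fun j _ => ?_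
    simp only [D, mul_sub, Finset.sum_sub_distrib]
    simp
    ring
  rw [h3, h5]
  simp only [hD, mul_assoc, ← Finset.mul_sum]
  simp only [mul_add, Finset.sum_add_distrib] at h4 ⊢
  rw [h4]
  ring

end ImmersedOn

theorem integral_pd_eq_zero {X : Euc n → ℝ} (hX : ContDiff ℝ 1 X) (hc : HasCompactSupport X)
    (i : Fin n) : ∫ w, pd i X w = 0 := by
  have hd : Continuous (pd i X) := (hX.continuous_fderiv (by norm_num)).clm_apply continuous_const
  have hcd : HasCompactSupport (pd i X) := hc.fderiv_apply ℝ (cvec i)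
  have h := integral_bilinear_hasLineDerivAt_right_eq_neg_left_of_integrable
    (μ := (volume : Measure (Euc n))) (f := fun _ : Euc n => (1 : ℝ)) (f' := fun _ => 0) (g := X)
    (g' := pd i X) (v := cvec i) (B := ContinuousLinearMap.mul ℝ ℝ)
    (by simp) (by simpa using hd.integrable_of_hasCompactSupport hcd)
    (by simpa using hX.continuous.integrable_of_hasCompactSupport hc)
    (fun w _ => by
      have := (hasFDerivAt_const (𝕜 := ℝ) (1 : ℝ) w).hasLineDerivAt (cvec i)
      simpa using this)
    (fun w _ => ((hX.differentiable (by norm_num)) w).hasFDerivAt.hasLineDerivAt (cvec i))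
  simpa using h

/-- Off the closed set `K` the field `b` vanishes locally, so the Green field is zero there whatever
`f` and `a` do outside `U`. It is thus `C¹` with compact support on all of `ℝⁿ`, and its divergence
integrates to zero. -/
theorem ImmersedOn.setIntegral_green (hf : ImmersedOn f U) {a b : Euc n → Euc N} {K : Set (Euc n)}
    (hK : IsCompact K) (hKU : K ⊆ U) (ha : ContDiffOn ℝ ∞ a U) (hb : ContDiffOn ℝ ∞ b U)
    (hb0 : ∀ w ∉ K, b w = 0) :
    ∫ w in K, ((inner ℝ (a w) (lap f b w) : ℝ) - inner ℝ (lap f a w) (b w)) * √(metric f w).det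
      = 0 := by
  have hzero : ∀ w ∉ K, b =ᶠ[𝓝 w] fun _ => 0 := fun w hw =>
    Filter.mem_of_superset (hK.isClosed.isOpen_compl.mem_nhds hw) hb0
  have hX0 : ∀ i, ∀ w ∉ K, greenField f a b i =ᶠ[𝓝 w] fun _ => 0 := by
    intro i w hw
    filter_upwards [hzero w hw, (Filter.eventually_all (l := 𝓝 w)).2
      fun j => pd_congr (hzero w hw) j] with z hz hz'
    refine Finset.sum_eq_zero fun j _ => ?_
    rw [hz' j, hz]
    simp [pd]
  have hXd : ∀ i, ContDiff ℝ 1 (greenField f a b i) := by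
    intro i
    refine contDiff_iff_contDiffAt.2 fun w => ?_
    by_cases hw : w ∈ K
    · have h1 : ContDiffOn ℝ ∞ (greenField f a b i) U := by
        have h2 := contDiffOn_pd hf.isOpen ha
        have h3 := contDiffOn_pd hf.isOpen hb
        unfold greenField
        exact ContDiffOn.sum fun j _ => (hf.contDiffOn_sqrt_det_metric.mul
          (hf.contDiffOn_metricInv i j)).mul ((ha.inner ℝ (h3 j)).sub ((h2 j).inner ℝ hb))
      exact (contDiffAt_two h1 hf.isOpen (hKU hw)).of_le (by norm_num)
    · exact contDiffAt_const.congr_of_eventuallyEq (hX0 i w hw)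
  have hXc : ∀ i, HasCompactSupport (greenField f a b i) := fun i =>
    HasCompactSupport.intro hK fun w hw => (hX0 i w hw).self_of_nhds
  have h1 : ∫ w in K, ((inner ℝ (a w) (lap f b w) : ℝ) - inner ℝ (lap f a w) (b w))
      * √(metric f w).det = ∫ w in K, ∑ i, pd i (greenField f a b i) w :=
    setIntegral_congr_fun hK.measurableSet fun w hw => (hf.sum_pd_greenField (hKU hw)
      (contDiffAt_two ha hf.isOpen (hKU hw)) (contDiffAt_two hb hf.isOpen (hKU hw))).symm
  rw [h1, setIntegral_eq_integral_of_forall_compl_eq_zero, integral_finsetSum]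
  · exact Finset.sum_eq_zero fun i _ => integral_pd_eq_zero (hXd i) (hXc i) i
  · intro i _
    exact (((hXd i).continuous_fderiv (by norm_num)).clm_apply
      continuous_const).integrable_of_hasCompactSupport ((hXc i).fderiv_apply ℝ (cvec i))
  · intro w hw
    refine Finset.sum_eq_zero fun i _ => ?_
    rw [(pd_congr (hX0 i w hw) i).self_of_nhds]
    simp [pd]

end Divergence

/-! ### The Riemannian volume in a chart -/

section Volume

variable {n N : ℕ} {M : Type*} [TopologicalSpace M] [MeasurableSpace M] [BorelSpace M]
  {x : M → Euc N} {e e' : OpenPartialHomeomorph M (Euc n)} {A : Set M}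

theorem measurableSet_target_inter_preimage (e : OpenPartialHomeomorph M (Euc n))
    (hA : MeasurableSet A) : MeasurableSet (e.target ∩ e.symm ⁻¹' A) := by
  have h1 : Measurable (fun u : e.target => e.symm u) :=
    (e.continuousOn_symm.domRestrict).measurable
  have h2 := e.open_target.measurableSet.subtype_image (h1 hA)
  convert h2 using 1
  ext u
  simp [and_comm]

/-- The map `e.symm` is arbitrary off `e.target`, so only almost everywhere measurability can be
expected. -/
theorem aemeasurable_symm (e : OpenPartialHomeomorph M (Euc n)) (ρ : Euc n → ENNReal) :
    AEMeasurable e.symm ((volume.restrict e.target).withDensity ρ) :=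
  (e.continuousOn_symm.aemeasurable e.open_target.measurableSet).mono_ac
    (withDensity_absolutelyContinuous _ _)

theorem chartVolume_apply [ChartedSpace (Euc n) M] (hA : MeasurableSet A) :
    chartVolume x e A = ∫⁻ u in e.target ∩ e.symm ⁻¹' A,
      ENNReal.ofReal √(metric (x ∘ e.symm) u).det := by
  rw [chartVolume, Measure.map_apply_of_aemeasurable (aemeasurable_symm e _) hA,
    withDensity_apply', Measure.restrict_restrict' e.open_target.measurableSet, inter_comm]
  rfl

variable [ChartedSpace (Euc n) M] [IsManifold (𝓡 n) ∞ M] (hx : IsSmoothImmersion (n := n) x)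
include hx

/-- Change of variables along the transition map: `√(det g)` picks up the absolute value of the
Jacobian determinant. -/
theorem chartVolume_apply_eq (he : e ∈ atlas (Euc n) M) (he' : e' ∈ atlas (Euc n) M)
    (hA : MeasurableSet A) (hAe : A ⊆ e.source) :
    chartVolume x e' A = chartVolume x e (A ∩ e'.source) := by
  rw [chartVolume_apply hA, chartVolume_apply (hA.inter e'.open_source.measurableSet)]
  have hs := measurableSet_target_inter_preimage e' hA
  have himg : e.target ∩ e.symm ⁻¹' (A ∩ e'.source)
      = (e ∘ e'.symm) '' (e'.target ∩ e'.symm ⁻¹' A) := by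
    ext u
    constructor
    · rintro ⟨hu, huA, hue⟩
      refine ⟨e' (e.symm u), ⟨e'.map_source hue, ?_⟩, ?_⟩
      · simpa [e'.left_inv hue] using huA
      · simp [e'.left_inv hue, e.right_inv hu]
    · rintro ⟨w, ⟨hw, hwA⟩, rfl⟩
      have hwe : e'.symm w ∈ e.source := hAe hwA
      refine ⟨e.map_source hwe, ?_⟩
      simpa [e.left_inv hwe, e'.map_target hw] using hwA
  have hinj : InjOn (e ∘ e'.symm) (e'.target ∩ e'.symm ⁻¹' A) := by
    rintro a ⟨ha, haA⟩ b ⟨hb, hbA⟩ hab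
    exact e'.symm.injOn ha hb (e.injOn (hAe haA) (hAe hbA) hab)
  have hder : ∀ w ∈ e'.target ∩ e'.symm ⁻¹' A, DifferentiableAt ℝ (e ∘ e'.symm) w :=
    fun w hw => (contDiffAt_two (contDiffOn_transition he he') (isOpen_transition_source e e')
      ⟨hw.1, hAe hw.2⟩).differentiableAt (by norm_num)
  rw [himg, lintegral_image_eq_lintegral_abs_det_fderiv_mul volume hs
    (fun w hw => (hder w hw).hasFDerivAt.hasFDerivWithinAt) hinj]
  refine setLIntegral_congr_fun hs fun w hw => ?_
  have hf : DifferentiableAt ℝ (x ∘ e.symm) ((e ∘ e'.symm) w) :=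
    ((hx.immersedOn he).contDiffAt (e.map_source (hAe hw.2))).differentiableAt (by norm_num)
  have hm : metric (x ∘ e'.symm) w = metric ((x ∘ e.symm) ∘ (e ∘ e'.symm)) w := by
    ext i j
    simp only [metric, Matrix.of_apply,
      (pd_congr (comp_symm_eventuallyEq_transition x hw.1 (hAe hw.2)) _).self_of_nhds]
  rw [hm, det_metric_comp hf (hder w hw), Real.sqrt_mul (sq_nonneg _), Real.sqrt_sq_eq_abs,
    ENNReal.ofReal_mul (abs_nonneg _)]

theorem inducedVolume_restrict_source (he : e ∈ atlas (Euc n) M) :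
    (inducedVolume n x).restrict e.source = (chartVolume x e).restrict e.source := by
  have hs := e.open_source.measurableSet
  have hle : ∀ e' ∈ atlas (Euc n) M, chartVolume x e' ≤ inducedVolume n x := fun e' he' =>
    le_iSup₂ (f := fun e' (_ : e' ∈ atlas (Euc n) M) => chartVolume x e') e' he'
  refine le_antisymm ?_ (Measure.restrict_mono le_rfl (hle e he))
  -- The supremum is the least upper bound, so it is enough that this sum dominates every chart
  -- measure. Its second summand disappears upon restriction to `e.source`.
  have hub : inducedVolume n x
      ≤ (chartVolume x e).restrict e.source + (inducedVolume n x).restrict e.sourceᶜ := by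
    refine iSup₂_le fun e' he' => Measure.le_iff.2 fun A hA => ?_
    rw [← measure_inter_add_sdiff A hs, Measure.add_apply, Measure.restrict_apply hA,
      Measure.restrict_apply hA]
    refine add_le_add ?_ (hle e' he' _)
    rw [chartVolume_apply_eq hx he he' (hA.inter hs) inter_subset_right]
    exact measure_mono inter_subset_left
  refine (Measure.restrict_mono le_rfl hub).trans ?_
  rw [Measure.restrict_add, Measure.restrict_restrict hs, Measure.restrict_restrict hs,
    inter_self, inter_compl_self, Measure.restrict_empty, add_zero]

theorem setIntegral_inducedVolume [T2Space M] (he : e ∈ atlas (Euc n) M) {K : Set M}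
    (hK : IsCompact K)
    (hKe : K ⊆ e.source) {G : M → ℝ} (hG : ContinuousOn (G ∘ e.symm) e.target) :
    ∫ p in K, G p ∂(inducedVolume n x)
      = ∫ u in e '' K, √(metric (x ∘ e.symm) u).det * G (e.symm u) := by
  have hKm := hK.measurableSet
  have hGK : ContinuousOn G K := by
    have h1 : ContinuousOn ((G ∘ e.symm) ∘ e) K :=
      hG.comp (e.continuousOn.mono hKe) fun p hp => e.map_source (hKe hp)
    refine h1.congr fun p hp => ?_
    simp [e.left_inv (hKe hp)]
  have h1 : (inducedVolume n x).restrict K = (chartVolume x e).restrict K := by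
    rw [← inter_eq_left.2 hKe, ← Measure.restrict_restrict hKm,
      inducedVolume_restrict_source hx he, Measure.restrict_restrict hKm]
  have hρ : ContinuousOn (fun u => ENNReal.ofReal √(metric (x ∘ e.symm) u).det) e.target :=
    ENNReal.continuous_ofReal.comp_continuousOn
      (hx.immersedOn he).contDiffOn_sqrt_det_metric.continuousOn
  have himg := e.image_eq_target_inter_inv_preimage hKe
  have hsub : e '' K ⊆ e.target := by rw [himg]; exact inter_subset_left
  have hKim : MeasurableSet (e '' K) :=
    (hK.image_of_continuousOn (e.continuousOn.mono hKe)).measurableSet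
  have hres : ((volume.restrict e.target).withDensity fun u =>
      ENNReal.ofReal √(metric (x ∘ e.symm) u).det).restrict (e.symm ⁻¹' K)
      = (volume.restrict (e '' K)).withDensity fun u =>
        ENNReal.ofReal √(metric (x ∘ e.symm) u).det := by
    rw [restrict_withDensity', Measure.restrict_restrict' e.open_target.measurableSet, inter_comm,
      himg]
  have hmap : (chartVolume x e).restrict K = Measure.map e.symm ((volume.restrict
      (e '' K)).withDensity fun u => ENNReal.ofReal √(metric (x ∘ e.symm) u).det) := by
    rw [← hres, chartVolume, Measure.restrict_map_of_aemeasurable (aemeasurable_symm e _) hKm]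
    rfl
  have hGm : AEStronglyMeasurable G ((chartVolume x e).restrict K) :=
    hGK.aestronglyMeasurable hKm
  rw [h1, hmap, integral_map, integral_withDensity_eq_integral_toReal_smul₀]
  · refine integral_congr_ae (Filter.Eventually.of_forall fun u => ?_)
    simp only [smul_eq_mul]
    rw [ENNReal.toReal_ofReal (Real.sqrt_nonneg _)]
  · exact (hρ.mono hsub).aemeasurable hKim
  · exact Filter.Eventually.of_forall fun u => ENNReal.ofReal_lt_top
  · exact ((e.continuousOn_symm.mono hsub).aemeasurable hKim).mono_ac
      (withDensity_absolutelyContinuous _ _)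
  · rwa [← hmap]

end Volume

/-! ### The first variation and the Euler-Lagrange identity -/

section FirstVariation

theorem hasDerivAt_quadratic (c₀ c₁ c₂ : ℝ) :
    HasDerivAt (fun t : ℝ => c₀ + t * c₁ + t ^ 2 * c₂) c₁ 0 := by
  have h : HasDerivAt (fun t : ℝ => c₀ + t * c₁ + t ^ 2 * c₂)
      (1 * c₁ + ((2 : ℕ) : ℝ) * 0 ^ (2 - 1) * c₂) 0 :=
    (((hasDerivAt_id (0 : ℝ)).mul_const c₁).const_add c₀).add
      ((hasDerivAt_pow 2 (0 : ℝ)).mul_const c₂)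
  simpa using h

theorem contDiff_of_contDiffOn_of_eq_zero {E W : Type*} [NormedAddCommGroup E] [NormedSpace ℝ E]
    [NormedAddCommGroup W] [NormedSpace ℝ W] {F : E → W} {U L : Set E} {m : ℕ∞} (hU : IsOpen U)
    (hL : IsClosed L) (hLU : L ⊆ U) (hF : ContDiffOn ℝ m F U) (h0 : ∀ w ∉ L, F w = 0) :
    ContDiff ℝ m F := by
  refine contDiff_iff_contDiffAt.2 fun w => ?_
  by_cases hw : w ∈ L
  · exact hF.contDiffAt (hU.mem_nhds (hLU hw))
  · exact (contDiffAt_const (c := (0 : W))).congr_of_eventuallyEq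
      (Filter.mem_of_superset (hL.isOpen_compl.mem_nhds hw) h0)

section Local

variable {n N : ℕ} {f v : Euc n → Euc N} {U : Set (Euc n)} {u : Euc n}

theorem pd_add_const_smul (hf : DifferentiableAt ℝ f u) (hv : DifferentiableAt ℝ v u) (t : ℝ)
    (i : Fin n) : pd i (fun w => f w + t • v w) u = pd i f u + t • pd i v u :=
  congrArg (fun L => L (cvec i)) (hf.hasFDerivAt.add (hv.hasFDerivAt.const_smul t)).fderiv

theorem normSqDiffLoc_add_const_smul (hf : DifferentiableAt ℝ f u) (hv : DifferentiableAt ℝ v u)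
    (t : ℝ) : normSqDiffLoc f (fun w => f w + t • v w) u
      = normSqDiffLoc f f u
        + t * (2 * ∑ i, ∑ j, metricInv f u i j * inner ℝ (pd i f u) (pd j v u))
        + t ^ 2 * normSqDiffLoc f v u := by
  have h1 : ∑ i, ∑ j, metricInv f u i j * inner ℝ (pd i v u) (pd j f u)
      = ∑ i, ∑ j, metricInv f u i j * (inner ℝ (pd i f u) (pd j v u) : ℝ) := by
    rw [Finset.sum_comm]
    refine Finset.sum_congr rfl fun i _ => Finset.sum_congr rfl fun j _ => ?_
    rw [metricInv_symm, real_inner_comm]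
  have h2 : normSqDiffLoc f (fun w => f w + t • v w) u = normSqDiffLoc f f u
        + t * (∑ i, ∑ j, metricInv f u i j * inner ℝ (pd i f u) (pd j v u)
        + ∑ i, ∑ j, metricInv f u i j * inner ℝ (pd i v u) (pd j f u))
        + t ^ 2 * normSqDiffLoc f v u := by
    simp only [normSqDiffLoc, pd_add_const_smul hf hv, Finset.mul_sum,
      ← Finset.sum_add_distrib]
    refine Finset.sum_congr rfl fun i _ => Finset.sum_congr rfl fun j _ => ?_
    simp only [inner_add_left, inner_add_right, inner_smul_left, inner_smul_right]
    simp
    ring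
  rw [h2, h1]
  ring

/-- For a normal field, the energy term of the first variation needs no integration by parts. -/
theorem sum_metricInv_inner_pd_of_normal (hf : ContDiffAt ℝ 2 f u) (hv : DifferentiableAt ℝ v u)
    (hn : ∀ᶠ w in 𝓝 u, ∀ j, inner ℝ (v w) (pd j f w) = (0 : ℝ)) :
    ∑ i, ∑ j, metricInv f u i j * (inner ℝ (pd i f u) (pd j v u) : ℝ)
      = - inner ℝ (lap f f u) (v u) := by
  have h0 : ∀ j, (inner ℝ (pd j f u) (v u) : ℝ) = 0 := fun j => by
    rw [real_inner_comm]; exact hn.self_of_nhds j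
  simp only [lap, sum_inner, inner_smul_left, inner_sub_left, h0, ← Finset.sum_neg_distrib]
  refine Finset.sum_congr rfl fun i _ => Finset.sum_congr rfl fun j _ => ?_
  rw [real_inner_comm, inner_pd_pd_of_normal hf hv (hn.mono fun w hw => hw i), pd_pd_symm hf j i,
    real_inner_comm (v u)]
  simp

theorem norm_add_smul_sq (a b : Euc N) (t : ℝ) :
    ‖a + t • b‖ ^ 2 = ‖a‖ ^ 2 + t * (2 * inner ℝ a b) + t ^ 2 * ‖b‖ ^ 2 := by
  rw [norm_add_sq_real, inner_smul_right, norm_smul, mul_pow, Real.norm_eq_abs, sq_abs]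
  ring

end Local

variable {n N : ℕ} {M : Type*} [TopologicalSpace M] [T2Space M] [MeasurableSpace M] [BorelSpace M]
  [ChartedSpace (Euc n) M] [IsManifold (𝓡 n) ∞ M]
  {x : M → Euc N} {e : OpenPartialHomeomorph M (Euc n)} {L : Set (Euc n)} {v : Euc n → Euc N}

/-- The field `v` of the coordinate domain of `e`, extended by zero to `M`. -/
def extendByZero (e : OpenPartialHomeomorph M (Euc n)) (v : Euc n → Euc N) (p : M) : Euc N :=
  open Classical in if p ∈ e.source then v (e p) else 0

omit [T2Space M] [MeasurableSpace M] [BorelSpace M] [ChartedSpace (Euc n) M]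
  [IsManifold (𝓡 n) ∞ M] in
theorem extendByZero_symm {u : Euc n} (hu : u ∈ e.target) :
    extendByZero e v (e.symm u) = v u := by
  simp [extendByZero, e.map_target hu, e.right_inv hu]

omit [T2Space M] [MeasurableSpace M] [BorelSpace M] [ChartedSpace (Euc n) M]
  [IsManifold (𝓡 n) ∞ M] in
theorem extendByZero_eq_zero (h0 : ∀ w ∉ L, v w = 0) {p : M} (hp : p ∉ e.symm '' L) :
    extendByZero e v p = 0 := by
  unfold extendByZero
  split_ifs with h
  · exact h0 _ fun hL => hp ⟨e p, hL, e.left_inv h⟩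
  · rfl

-- The Hausdorff property enters here: the compact set `e.symm '' L` is closed, so the extension
-- vanishes near every point outside the chart domain.
omit [MeasurableSpace M] [BorelSpace M] in
theorem contMDiff_extendByZero (he : e ∈ atlas (Euc n) M) (hL : IsCompact L) (hLe : L ⊆ e.target)
    (hv : ContDiffOn ℝ ∞ v e.target) (h0 : ∀ w ∉ L, v w = 0) :
    ContMDiff (𝓡 n) 𝓘(ℝ, Euc N) ∞ (extendByZero e v) := by
  intro p
  by_cases hp : p ∈ e.source
  · have h1 : ContMDiffAt (𝓡 n) 𝓘(ℝ, Euc N) ∞ (v ∘ e) p :=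
      ((contMDiffOn_iff_contDiffOn.2 hv).contMDiffAt
        (e.open_target.mem_nhds (e.map_source hp))).comp p
        ((contMDiffOn_of_mem_maximalAtlas (IsManifold.subset_maximalAtlas he)).contMDiffAt
          (e.open_source.mem_nhds hp))
    refine h1.congr_of_eventuallyEq ?_
    filter_upwards [e.open_source.mem_nhds hp] with q hq
    simp [extendByZero, hq]
  · have hK : IsClosed (e.symm '' L) :=
      (hL.image_of_continuousOn (e.continuousOn_symm.mono hLe)).isClosed
    have hpK : p ∉ e.symm '' L := by
      rintro ⟨w, hw, rfl⟩
      exact hp (e.map_target (hLe hw))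
    refine (contMDiffAt_const (c := (0 : Euc N))).congr_of_eventuallyEq ?_
    filter_upwards [hK.isOpen_compl.mem_nhds hpK] with q hq
    exact extendByZero_eq_zero h0 hq

variable (hx : IsSmoothImmersion (n := n) x)
include hx

omit [T2Space M] [MeasurableSpace M] [BorelSpace M] in
theorem mfderiv_eq_fderiv_chart (he : e ∈ atlas (Euc n) M) {p : M} (hp : p ∈ e.source)
    (w : TangentSpace (𝓡 n) p) :
    ∃ z : Euc n, (mfderiv (𝓡 n) 𝓘(ℝ, Euc N) x p w : Euc N) = fderiv ℝ (x ∘ e.symm) (e p) z := by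
  have h1 : x =ᶠ[𝓝 p] (x ∘ e.symm) ∘ e := by
    filter_upwards [e.open_source.mem_nhds hp] with q hq
    simp [e.left_inv hq]
  have h2 : e.MDifferentiable (𝓡 n) (𝓡 n) := mdifferentiable_of_mem_atlas he
  have h3 : DifferentiableAt ℝ (x ∘ e.symm) (e p) :=
    ((hx.immersedOn he).contDiffAt (e.map_source hp)).differentiableAt (by norm_num)
  rw [h1.mfderiv_eq, mfderiv_comp p h3.mdifferentiableAt (h2.mdifferentiableAt hp),
    mfderiv_eq_fderiv]
  exact ⟨_, rfl⟩

omit [MeasurableSpace M] [BorelSpace M] in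
theorem isNormalVariation_extendByZero (he : e ∈ atlas (Euc n) M) (hL : IsCompact L)
    (hLe : L ⊆ e.target) (hv : ContDiffOn ℝ ∞ v e.target) (h0 : ∀ w ∉ L, v w = 0)
    (hn : ∀ u ∈ e.target, ∀ j, inner ℝ (v u) (pd j (x ∘ e.symm) u) = (0 : ℝ)) :
    IsNormalVariation n x (e.symm '' L) 1 fun t p => x p + t • extendByZero e v p where
  pos := one_pos
  compact := hL.image_of_continuousOn (e.continuousOn_symm.mono hLe)
  smooth := ((hx.1.comp contMDiff_snd).add (contMDiff_fst.smul
    ((contMDiff_extendByZero he hL hLe hv h0).comp contMDiff_snd))).contMDiffOn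
  start := by simp
  fixed := fun t _ p hp => by rw [extendByZero_eq_zero h0 hp, smul_zero, add_zero]
  normal := fun p w => by
    have h1 : deriv (fun t : ℝ => x p + t • extendByZero e v p) 0 = extendByZero e v p := by
      have := ((hasDerivAt_id (0 : ℝ)).smul_const (extendByZero e v p)).const_add (x p)
      rw [one_smul] at this
      exact this.deriv
    rw [h1]
    by_cases hp : p ∈ e.source
    · obtain ⟨z, hz⟩ := mfderiv_eq_fderiv_chart hx he hp w
      rw [hz]
      have h2 : extendByZero e v p = v (e p) := by simp [extendByZero, hp]
      rw [h2]
      exact (inner_fderiv_eq_zero_iff _).2 (hn _ (e.map_source hp)) z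
    · have h2 : extendByZero e v p = 0 := by simp [extendByZero, hp]
      rw [h2]
      exact inner_zero_left _

/-- The energy of the variation `x + t v` in a chart. -/
theorem biEnergy_add_smul_extendByZero (he : e ∈ atlas (Euc n) M) (hL : IsCompact L)
    (hLe : L ⊆ e.target) (hv : ContDiffOn ℝ ∞ v e.target) (lam t : ℝ) :
    biEnergy n x lam (e.symm '' L) (fun p => x p + t • extendByZero e v p)
      = 1 / 2 * (∫ u in L, √(metric (x ∘ e.symm) u).det
          * ‖lap (x ∘ e.symm) (x ∘ e.symm) u + t • lap (x ∘ e.symm) v u‖ ^ 2)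
        + lam * (1 / 2 * ∫ u in L, √(metric (x ∘ e.symm) u).det
          * normSqDiffLoc (x ∘ e.symm) (fun w => (x ∘ e.symm) w + t • v w) u) := by
  have hf := hx.immersedOn he
  set f := x ∘ e.symm with hfdef
  set φ : M → Euc N := fun p => x p + t • extendByZero e v p with hφ
  have hK : IsCompact (e.symm '' L) := hL.image_of_continuousOn (e.continuousOn_symm.mono hLe)
  have hKe : e.symm '' L ⊆ e.source := by
    rintro _ ⟨w, hw, rfl⟩; exact e.map_target (hLe hw)
  have himg : e '' (e.symm '' L) = L := by
    rw [image_image]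
    exact (image_congr fun w hw => e.right_inv (hLe hw)).trans (image_id' L)
  have hφe : EqOn (φ ∘ e.symm) (fun w => f w + t • v w) e.target := fun w hw => by
    simp [hφ, hfdef, extendByZero_symm hw]
  have hφs : ContDiffOn ℝ ∞ (fun w => f w + t • v w) e.target :=
    hf.contDiffOn.add (hv.const_smul t)
  have hφs' : ContDiffOn ℝ ∞ (φ ∘ e.symm) e.target := hφs.congr hφe
  have hev : ∀ u ∈ e.target, φ ∘ e.symm =ᶠ[𝓝 u] fun w => f w + t • v w := fun u hu =>
    Filter.mem_of_superset (e.open_target.mem_nhds hu) hφe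
  have hten : ∀ u ∈ e.target, tension (n := n) x φ (e.symm u)
      = lap f (fun w => f w + t • v w) u := by
    intro u hu
    have h1 := tension_eq hx he (e.map_target hu) (φ := φ)
    rw [e.right_inv hu] at h1
    rw [h1 (contDiffAt_two hφs' e.open_target hu)]
    exact lap_congr (Filter.EventuallyEq.refl _ _) (hev u hu)
  have hten' : ∀ u ∈ e.target, lap f (fun w => f w + t • v w) u
      = lap f f u + t • lap f v u := by
    intro u hu
    have hi := hf.injective u hu
    have h2 := hf.contDiffAt hu
    have h3 := contDiffAt_two hv e.open_target hu
    rw [lap_add hi h2 h2 (h3.const_smul t), lap_const_smul hi h2 h3]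
  have hnrm : ∀ u ∈ e.target, normSqDiff (n := n) x φ (e.symm u)
      = normSqDiffLoc f (fun w => f w + t • v w) u := by
    intro u hu
    have h1 := normSqDiff_eq hx he (e.map_target hu) (φ := φ)
    rw [e.right_inv hu] at h1
    rw [h1 (contDiffAt_two hφs' e.open_target hu)]
    exact normSqDiffLoc_congr (Filter.EventuallyEq.refl _ _) (hev u hu)
  have hc1 : ContinuousOn ((fun p => ‖tension (n := n) x φ p‖ ^ 2) ∘ e.symm) e.target :=
    (((hf.contDiffOn_lap hφs).continuousOn.norm).pow 2).congr fun u hu => by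
      simp [hten u hu]
  have hc2 : ContinuousOn (normSqDiff (n := n) x φ ∘ e.symm) e.target :=
    (hf.contDiffOn_normSqDiffLoc hφs).continuousOn.congr fun u hu => hnrm u hu
  unfold biEnergy
  rw [setIntegral_inducedVolume hx he hK hKe hc1, setIntegral_inducedVolume hx he hK hKe hc2, himg]
  congr 2
  · refine setIntegral_congr_fun hL.measurableSet fun u hu => ?_
    beta_reduce
    rw [hten u (hLe hu), hten' u (hLe hu)]
  · congr 1
    refine setIntegral_congr_fun hL.measurableSet fun u hu => ?_
    beta_reduce
    rw [hnrm u (hLe hu)]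

/-- The variation is affine in `t` and the metric stays fixed, so the energy is a quadratic
polynomial in `t`. Its derivative at 0 is the linear coefficient, and no differentiation under the
integral is needed. -/
theorem firstVariation_eq_zero {lam : ℝ} (h : IsBiminimal n x lam) (he : e ∈ atlas (Euc n) M)
    (hL : IsCompact L) (hLe : L ⊆ e.target) (hv : ContDiffOn ℝ ∞ v e.target)
    (h0 : ∀ w ∉ L, v w = 0)
    (hn : ∀ u ∈ e.target, ∀ j, inner ℝ (v u) (pd j (x ∘ e.symm) u) = (0 : ℝ)) :
    ∫ u in L, √(metric (x ∘ e.symm) u).det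
      * (inner ℝ (lap (x ∘ e.symm) (x ∘ e.symm) u) (lap (x ∘ e.symm) v u)
        - lam * inner ℝ (lap (x ∘ e.symm) (x ∘ e.symm) u) (v u)) = 0 := by
  have hf := hx.immersedOn he
  have hE := fun t => biEnergy_add_smul_extendByZero hx he hL hLe hv lam t
  have hd := h _ _ _ (isNormalVariation_extendByZero hx he hL hLe hv h0 hn)
  set f := x ∘ e.symm with hfdef
  let w : Euc n → ℝ := fun u => √(metric f u).det
  have hw : ContinuousOn w L := hf.contDiffOn_sqrt_det_metric.continuousOn.mono hLe
  have hA : ContinuousOn (lap f f) L := (hf.contDiffOn_lap hf.contDiffOn).continuousOn.mono hLe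
  have hB : ContinuousOn (lap f v) L := (hf.contDiffOn_lap hv).continuousOn.mono hLe
  have hvc : ContinuousOn v L := hv.continuousOn.mono hLe
  have hQ0 : ContinuousOn (normSqDiffLoc f f) L :=
    (hf.contDiffOn_normSqDiffLoc hf.contDiffOn).continuousOn.mono hLe
  have hQ2 : ContinuousOn (normSqDiffLoc f v) L :=
    (hf.contDiffOn_normSqDiffLoc hv).continuousOn.mono hLe
  let P₀ : Euc n → ℝ := fun u => w u * (1 / 2 * ‖lap f f u‖ ^ 2 + lam / 2 * normSqDiffLoc f f u)
  let P₁ : Euc n → ℝ := fun u => w u * (inner ℝ (lap f f u) (lap f v u)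
    - lam * inner ℝ (lap f f u) (v u))
  let P₂ : Euc n → ℝ := fun u => w u * (1 / 2 * ‖lap f v u‖ ^ 2 + lam / 2 * normSqDiffLoc f v u)
  have hP₀ : IntegrableOn P₀ L := (hw.mul ((continuousOn_const.mul (hA.norm.pow 2)).add
    (continuousOn_const.mul hQ0))).integrableOn_compact hL
  have hP₁ : IntegrableOn P₁ L := (hw.mul ((hA.inner hB).sub
    (continuousOn_const.mul (hA.inner hvc)))).integrableOn_compact hL
  have hP₂ : IntegrableOn P₂ L := (hw.mul ((continuousOn_const.mul (hB.norm.pow 2)).add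
    (continuousOn_const.mul hQ2))).integrableOn_compact hL
  have hnorm : ∀ u ∈ L, ∀ t : ℝ, normSqDiffLoc f (fun w => f w + t • v w) u
      = normSqDiffLoc f f u + t * (2 * - inner ℝ (lap f f u) (v u))
        + t ^ 2 * normSqDiffLoc f v u := by
    intro u hu t
    have h1 := hf.contDiffAt (hLe hu)
    have h2 := (contDiffAt_two hv e.open_target (hLe hu)).differentiableAt (by norm_num)
    rw [normSqDiffLoc_add_const_smul (h1.differentiableAt (by norm_num)) h2,
      sum_metricInv_inner_pd_of_normal h1 h2
        (Filter.mem_of_superset (e.open_target.mem_nhds (hLe hu)) hn)]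
  have hquad : (fun t => biEnergy n x lam (e.symm '' L) fun p => x p + t • extendByZero e v p)
      = fun t => (∫ u in L, P₀ u) + t * (∫ u in L, P₁ u) + t ^ 2 * ∫ u in L, P₂ u := by
    funext t
    have hc : ContinuousOn (fun u => normSqDiffLoc f f u
        + t * (2 * - inner ℝ (lap f f u) (v u)) + t ^ 2 * normSqDiffLoc f v u) L :=
      (hQ0.add (continuousOn_const.mul (continuousOn_const.mul (hA.inner hvc).neg))).add
        (continuousOn_const.mul hQ2)
    have hi1 : IntegrableOn (fun u => w u * ‖lap f f u + t • lap f v u‖ ^ 2) L :=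
      (hw.mul ((hA.add (hB.const_smul t)).norm.pow 2)).integrableOn_compact hL
    have hi2 : IntegrableOn (fun u => w u * normSqDiffLoc f (fun w => f w + t • v w) u) L :=
      (hw.mul (hc.congr fun u hu => hnorm u hu t)).integrableOn_compact hL
    have hi3 : IntegrableOn (fun u => P₀ u + t * P₁ u) L := hP₀.add (hP₁.const_mul t)
    rw [hE t, ← integral_const_mul t, ← integral_const_mul (t ^ 2), ← integral_add hP₀
      (hP₁.const_mul t), ← integral_add hi3 (hP₂.const_mul (t ^ 2)),
      ← mul_assoc lam, ← integral_const_mul, ← integral_const_mul,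
      ← integral_add (hi1.const_mul _) (hi2.const_mul _)]
    refine setIntegral_congr_fun hL.measurableSet fun u hu => ?_
    beta_reduce
    rw [hnorm u hu, norm_add_smul_sq]
    simp only [P₀, P₁, P₂, w]
    ring
  rw [hquad] at hd
  exact (hasDerivAt_quadratic _ _ _).unique hd

/-- Substitute `Δf = nH` in the first variation, move the Laplacian from `v` to `H` by Green's
formula, and cancel `n ≠ 0`. -/
theorem setIntegral_inner_eulerLagrange_eq_zero (hn : 1 ≤ n) {lam : ℝ} (h : IsBiminimal n x lam)
    (he : e ∈ atlas (Euc n) M)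
    (hL : IsCompact L) (hLe : L ⊆ e.target) (hv : ContDiffOn ℝ ∞ v e.target)
    (h0 : ∀ w ∉ L, v w = 0)
    (hnor : ∀ u ∈ e.target, ∀ j, inner ℝ (v u) (pd j (x ∘ e.symm) u) = (0 : ℝ)) :
    ∫ u in L, √(metric (x ∘ e.symm) u).det
      * inner ℝ (lap (x ∘ e.symm) (meanCurvatureLoc (x ∘ e.symm)) u
        - lam • meanCurvatureLoc (x ∘ e.symm) u) (v u) = 0 := by
  have hf := hx.immersedOn he
  have h1 := firstVariation_eq_zero hx h he hL hLe hv h0 hnor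
  have hH := hf.contDiffOn_meanCurvatureLoc
  have h2 := hf.setIntegral_green hL hLe hH hv h0
  set f := x ∘ e.symm with hfdef
  set H := meanCurvatureLoc f with hHdef
  have hn' : (n : ℝ) ≠ 0 := by positivity
  have hw : ContinuousOn (fun u => √(metric f u).det) L :=
    hf.contDiffOn_sqrt_det_metric.continuousOn.mono hLe
  have hHc : ContinuousOn H L := hH.continuousOn.mono hLe
  have hA : ContinuousOn (lap f H) L := (hf.contDiffOn_lap hH).continuousOn.mono hLe
  have hB : ContinuousOn (lap f v) L := (hf.contDiffOn_lap hv).continuousOn.mono hLe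
  have hvc : ContinuousOn v L := hv.continuousOn.mono hLe
  have hi1 : IntegrableOn (fun u => ((inner ℝ (H u) (lap f v u) : ℝ) - inner ℝ (lap f H u) (v u))
      * √(metric f u).det) L :=
    (((hHc.inner hB).sub (hA.inner hvc)).mul hw).integrableOn_compact hL
  have hi2 : IntegrableOn (fun u => √(metric f u).det
      * (inner ℝ (lap f H u - lam • H u) (v u) : ℝ)) L :=
    (hw.mul ((hA.sub (hHc.const_smul lam)).inner hvc)).integrableOn_compact hL
  have h3 : ∫ u in L, √(metric f u).det * (inner ℝ (lap f f u) (lap f v u)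
        - lam * inner ℝ (lap f f u) (v u))
      = ∫ u in L, n * (((inner ℝ (H u) (lap f v u) : ℝ) - inner ℝ (lap f H u) (v u))
        * √(metric f u).det + √(metric f u).det * inner ℝ (lap f H u - lam • H u) (v u)) := by
    refine setIntegral_congr_fun hL.measurableSet fun u hu => ?_
    beta_reduce
    rw [lap_self (hf.injective u (hLe hu)) (hf.contDiffAt (hLe hu)), inner_smul_left,
      inner_smul_left, inner_sub_left, inner_smul_left, ← hHdef]
    simp
    ring
  rw [h3, integral_const_mul, integral_add hi1 hi2, h2, zero_add] at h1
  exact (mul_eq_zero.1 h1).resolve_left hn'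

/-- The full normal equation is not needed. Testing with multiples of `H`, which are automatically
normal, gives its `H`-component. -/
theorem inner_tension_meanCurvature_of_isBiminimal (hn : 1 ≤ n) {lam : ℝ}
    (h : IsBiminimal n x lam) (p : M) :
    inner ℝ (tension (n := n) x (meanCurvature (n := n) x) p) (meanCurvature (n := n) x p)
      = lam * ‖meanCurvature (n := n) x p‖ ^ 2 := by
  have he := chart_mem_atlas (Euc n) p
  have hf := hx.immersedOn he
  have hH := hf.contDiffOn_meanCurvatureLoc
  have hev : (chartAt (Euc n) p).target ∈ 𝓝 (chartAt (Euc n) p p) :=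
    (chartAt (Euc n) p).open_target.mem_nhds (mem_chart_target _ _)
  rw [tension_eq hx he (mem_chart_source _ _) (contDiffAt_two
    (contDiffOn_meanCurvature_comp_symm hx he) (chartAt (Euc n) p).open_target
      (mem_chart_target _ _)),
    lap_congr (Filter.EventuallyEq.refl _ _) (Filter.mem_of_superset hev
      fun w hw => meanCurvature_comp_symm hx he hw), meanCurvature_eq hx he (mem_chart_source _ p)]
  set e := chartAt (Euc n) p
  set f := x ∘ e.symm
  set H := meanCurvatureLoc f
  let θ : Euc n → ℝ := fun u => inner ℝ (lap f H u - lam • H u) (H u)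
  have hθ : ContDiffOn ℝ ∞ θ e.target :=
    ((hf.contDiffOn_lap hH).sub (hH.const_smul lam)).inner ℝ hH
  suffices hθ0 : θ (e p) = 0 by
    simp only [θ, inner_sub_left, inner_smul_left, real_inner_self_eq_norm_sq] at hθ0
    simpa using sub_eq_zero.1 hθ0
  obtain ⟨r, hr, hrU⟩ := Metric.nhds_basis_closedBall.mem_iff.1 hev
  let η : ContDiffBump (e p) := ⟨r / 2, r, by positivity, by linarith⟩
  have hη0 : ∀ w ∉ Metric.closedBall (e p) r, η w = 0 := fun w hw =>
    η.zero_of_le_dist (by simpa using (not_le.1 hw).le)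
  have hη : ContDiffOn ℝ ∞ (fun w => η w * θ w) e.target := η.contDiff.contDiffOn.mul hθ
  have hL : IsCompact (Metric.closedBall (e p) r) := isCompact_closedBall _ _
  -- The test field is `ηθH`. The factor `θ` makes the integrand the nonnegative function `√(det g)
  -- ηθ²`, which is positive at `e p` unless `θ` vanishes there.
  have h1 := setIntegral_inner_eulerLagrange_eq_zero hx hn h he hL hrU (hη.smul hH)
    (fun w hw => by simp [hη0 w hw])
    (fun u hu j => by
      rw [Pi.smul_apply', inner_smul_left, inner_meanCurvatureLoc_pd (hf.injective u hu), mul_zero])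
  let g : Euc n → ℝ := fun u => √(metric f u).det * (η u * θ u ^ 2)
  have hg0 : ∀ w ∉ Metric.closedBall (e p) r, g w = 0 := fun w hw => by simp [g, hη0 w hw]
  have hgc : Continuous g := by
    refine contDiff_zero.1 (contDiff_of_contDiffOn_of_eq_zero (m := 0) e.open_target
      Metric.isClosed_closedBall hrU (ContDiffOn.of_le (n := ∞) ?_ (by simp)) hg0)
    exact hf.contDiffOn_sqrt_det_metric.mul (η.contDiff.contDiffOn.mul (hθ.pow 2))
  have h2 : ∫ u, g u = 0 := by
    rw [← setIntegral_eq_integral_of_forall_compl_eq_zero hg0, ← h1]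
    refine setIntegral_congr_fun hL.measurableSet fun u hu => ?_
    simp only [g, θ, Pi.smul_apply', inner_smul_right]
    ring
  by_contra hne
  have hpos := hgc.integral_pos_of_hasCompactSupport_nonneg_nonzero
    (μ := (volume : Measure (Euc n))) (x := e p) (HasCompactSupport.intro hL hg0)
    (fun u => mul_nonneg (Real.sqrt_nonneg _) (mul_nonneg η.nonneg (sq_nonneg _)))
    (by
      have h3 : η (e p) = 1 := η.one_of_mem_closedBall (by simp [η.rIn_pos.le])
      have h4 : √(metric f (e p)).det ≠ 0 :=
        (Real.sqrt_pos.2 (det_metric_pos (hf.injective _ (mem_chart_target _ _)))).ne'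
      simp only [g, h3, one_mul]
      exact mul_ne_zero h4 (pow_ne_zero 2 hne))
  exact hpos.ne' h2

end FirstVariation

end BiminimalSubmanifold

end

open BiminimalSubmanifold in
theorem mainTheorem1 {n N : ℕ} {M : Type*} [TopologicalSpace M] [T2Space M]
    [SecondCountableTopology M] [MeasurableSpace M] [BorelSpace M]
    [ChartedSpace (Euc n) M] [IsManifold (𝓡 n) ∞ M]
    (x : M → Euc N) (hx : IsSmoothImmersion (n := n) x) (hproper : IsProperMap x)
    (lam : ℝ) (hlam : 0 ≤ lam)
    (hbim : IsBiminimal n x lam ∨ BiminimalEquation n x lam) :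
    ∀ p : M, meanCurvature (n := n) x p = 0 := by
  intro p
  -- In dimension 0 the mean curvature is an empty sum; the main argument divides by `n`.
  rcases Nat.eq_zero_or_pos n with rfl | hn
  · simp [meanCurvature, meanCurvatureLoc]
  · refine meanCurvature_eq_zero hx hproper hlam hn (fun q => ?_) p
    rcases hbim with h | h
    · exact inner_tension_meanCurvature_of_isBiminimal hx hn h q
    · exact inner_tension_meanCurvature_of_biminimalEquation hx h q
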